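/- Let $b$ be a smooth axisymmetric vector field on $\mathbb R^3$ of the form $b=b^\theta(r,z)\,e_\theta$, that is, $R_{-\alpha}\,b(R_\alpha x)=b(x)$ for every rotation $R_\alpha$ about the vertical axis, with trivial radial and vertical components $b^r=0$ and $b^z=0$; here $(r,\theta,z)$ are cylindrical coordinates, with basis $(e_r,e_\theta,e_z)$. Let $\chi,\varphi\ge 0$ be smooth compactly supported radial functions on $\mathbb R^3$, $\varphi$ supported away from $0$, with $\chi(\xi)+\sum_{q\ge0}\varphi(2^{-q}\xi)=1$ for all $\xi$, $\sum_{q\in\mathbb Z}\varphi(2^{-q}\xi)=1$ for $\xi\ne0$, $\operatorname{supp}\varphi(2^{-j}\cdot)\cap\operatorname{supp}\varphi(2^{-q}\cdot)=\varnothing$ for $|j-q|\ge2$ and $\operatorname{supp}\chi\cap\operatorname{supp}\varphi(2^{-q}\cdot)=\varnothing$ for $q\ge1$. Set $\Delta_q u=2^{3q}(\mathcal F^{-1}\varphi)(2^q\cdot)*u$ for $q\ge0$, $\Delta_{-1}u=(\mathcal F^{-1}\chi)*u$, $\Delta_q u=0$ for $q\le-2$, and $$\|u\|_{B^s_{p,r}}=\Big\|\big(2^{qs}\|\Delta_q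 u\|_{L^p}\big)_{q}\Big\|_{\ell^r(\mathbb Z)},\qquad \|u\|_{\widetilde L^1_tH^s}=\Big\|\big(2^{qs}\|\Delta_q u\|_{L^1((0,t);L^2)}\big)_{q}\Big\|_{\ell^2(\mathbb Z)}.$$ (i) For every $s>0$ there is a constant $C$, depending only on $s$ (and on $\chi,\varphi$), such that for every $t>0$ and every time-dependent field $b$ which is of the above form at each time in $(0,t)$ and satisfies $b^\theta/r\in L^\infty((0,t);L^\infty)$, $$\Big\|\frac{b^\theta}{r}\,b\Big\|_{\widetilde L^1_tH^s}\le C\,\Big\|\frac{b^\theta}{r}\Big\|_{L^\infty_tL^\infty}\,\|b\|_{\widetilde L^1_tH^s}.$$ (ii) For every $p\in[1,\infty]$ there is a constant $C$, depending only on $p$ (and on $\chi,\varphi$), such that for every $b$ of the above form with $b^\theta/r\in L^\infty$, $$\Big\|\frac{b^\theta}{r}\,b\Big\|_{B^{3/p+1}_{p,1}}\le C\,\Big\|\frac{b^\theta}{r}\Big\|_{L^\infty}\,\|b\|_{B^{3/p+1}_{p,1}}.$$ The norms of $b$ may be infinite, in which case the inequalities are trivial. -/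

import Mathlib

open MeasureTheory
open scoped ENNReal NNReal ContDiff FourierTransform Convolution

noncomputable section

namespace AxisymmetricProduct

/-- Physical space `ℝ³` with the Euclidean norm. -/
abbrev E3 : Type := EuclideanSpace ℝ (Fin 3)

/-! ### Littlewood-Paley decomposition -/

/-- A dyadic partition of unity `(χ, φ)` on `ℝ³`. -/
structure DyadicPartition where
  χ : E3 → ℝ
  φ : E3 → ℝ
  χ_smooth : ContDiff ℝ ∞ χ
  φ_smooth : ContDiff ℝ ∞ φ
  χ_compact : HasCompactSupport χ
  φ_compact : HasCompactSupport φ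
  φ_away : (0 : E3) ∉ tsupport φ
  χ_nonneg : ∀ ξ, 0 ≤ χ ξ
  φ_nonneg : ∀ ξ, 0 ≤ φ ξ
  χ_radial : ∀ ξ η : E3, ‖ξ‖ = ‖η‖ → χ ξ = χ η
  φ_radial : ∀ ξ η : E3, ‖ξ‖ = ‖η‖ → φ ξ = φ η
  sum_inhom : ∀ ξ : E3, HasSum (fun q : ℕ => φ ((2 : ℝ) ^ (-(q : ℤ)) • ξ)) (1 - χ ξ)
  sum_hom : ∀ ξ : E3, ξ ≠ 0 → HasSum (fun q : ℤ => φ ((2 : ℝ) ^ (-q) • ξ)) 1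
  φ_disjoint : ∀ j q : ℤ, 2 ≤ |j - q| →
    Disjoint (tsupport fun ξ : E3 => φ ((2 : ℝ) ^ (-j) • ξ))
      (tsupport fun ξ : E3 => φ ((2 : ℝ) ^ (-q) • ξ))
  χ_disjoint : ∀ q : ℤ, 1 ≤ q →
    Disjoint (tsupport χ) (tsupport fun ξ : E3 => φ ((2 : ℝ) ^ (-q) • ξ))

/-- The radial profile of the standard cut-off: `1` for `‖ξ‖ ≤ 3/4` and `0` for `‖ξ‖ ≥ 4/3`. -/
def cutoff (ξ : E3) : ℝ := Real.smoothTransition ((16 / 9 - ‖ξ‖ ^ 2) / (175 / 144))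

theorem cutoff_one {ξ : E3} (h : ‖ξ‖ ≤ 3 / 4) : cutoff ξ = 1 := by
  apply Real.smoothTransition.one_of_one_le
  have := norm_nonneg ξ
  rw [le_div_iff₀ (by norm_num)]
  nlinarith

theorem cutoff_zero {ξ : E3} (h : 4 / 3 ≤ ‖ξ‖) : cutoff ξ = 0 := by
  apply Real.smoothTransition.zero_of_nonpos
  apply div_nonpos_of_nonpos_of_nonneg _ (by norm_num)
  nlinarith

theorem cutoff_smooth : ContDiff ℝ ∞ cutoff :=
  Real.smoothTransition.contDiff.comp
    ((contDiff_const.sub (contDiff_id.norm_sq ℝ)).div_const _)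

/-- The annular cut-off attached to `cutoff`. -/
def annulus (ξ : E3) : ℝ := cutoff ((2 : ℝ)⁻¹ • ξ) - cutoff ξ

theorem annulus_nonneg (ξ : E3) : 0 ≤ annulus ξ := by
  apply sub_nonneg.2
  apply Real.smoothTransition.monotone
  have h : ‖(2 : ℝ)⁻¹ • ξ‖ ^ 2 ≤ ‖ξ‖ ^ 2 := by
    rw [norm_smul, mul_pow]
    norm_num
    nlinarith [sq_nonneg ‖ξ‖]
  gcongr

theorem tsupport_cutoff : tsupport cutoff ⊆ {ξ | ‖ξ‖ ≤ 4 / 3} := by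
  apply closure_minimal _ (isClosed_le continuous_norm continuous_const)
  intro ξ hξ
  by_contra h
  exact hξ (cutoff_zero (le_of_lt (not_le.1 h)))

theorem tsupport_annulus (j : ℤ) :
    tsupport (fun ξ : E3 => annulus ((2 : ℝ) ^ (-j) • ξ)) ⊆
      {ξ | 3 / 4 * (2 : ℝ) ^ j ≤ ‖ξ‖ ∧ ‖ξ‖ ≤ 8 / 3 * (2 : ℝ) ^ j} := by
  apply closure_minimal _ ((isClosed_le continuous_const continuous_norm).inter
    (isClosed_le continuous_norm continuous_const))
  intro ξ hξ
  have hp : (0 : ℝ) < 2 ^ j := by positivity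
  have hn : ‖(2 : ℝ) ^ (-j) • ξ‖ = ‖ξ‖ / 2 ^ j := by
    rw [norm_smul, zpow_neg, norm_inv, Real.norm_of_nonneg hp.le]
    field_simp
  have hn2 : ‖(2 : ℝ)⁻¹ • (2 : ℝ) ^ (-j) • ξ‖ = ‖ξ‖ / 2 ^ j / 2 := by
    rw [norm_smul, hn]
    norm_num
    ring
  constructor
  · by_contra h
    have h1 : ‖ξ‖ / 2 ^ j < 3 / 4 := (div_lt_iff₀ hp).2 (not_le.1 h)
    have h0 : 0 ≤ ‖ξ‖ / 2 ^ j := by positivity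
    apply hξ
    simp only [annulus]
    rw [cutoff_one (hn.le.trans h1.le), cutoff_one (hn2.le.trans (by linarith)), sub_self]
  · by_contra h
    have h1 : 8 / 3 < ‖ξ‖ / 2 ^ j := (lt_div_iff₀ hp).2 (not_le.1 h)
    apply hξ
    simp only [annulus]
    rw [cutoff_zero (le_trans (by linarith) hn.ge), cutoff_zero (le_trans (by linarith) hn2.ge),
      sub_self]

theorem annulus_disjoint {i q : ℤ} (h : i + 2 ≤ q) :
    Disjoint (tsupport fun ξ : E3 => annulus ((2 : ℝ) ^ (-i) • ξ))
      (tsupport fun ξ : E3 => annulus ((2 : ℝ) ^ (-q) • ξ)) := by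
  rw [Set.disjoint_left]
  intro ξ h1 h2
  have h1 := (tsupport_annulus i h1).2
  have h2 := (tsupport_annulus q h2).1
  have h3 : (2 : ℝ) ^ (i + 2) ≤ 2 ^ q := zpow_le_zpow_right₀ (by norm_num) h
  rw [zpow_add₀ (by norm_num)] at h3
  have hp : (0 : ℝ) < 2 ^ i := by positivity
  norm_num at h3
  linarith

theorem annulus_hasSum_nonneg (ξ : E3) :
    HasSum (fun q : ℕ => annulus ((2 : ℝ) ^ (-(q : ℤ)) • ξ)) (1 - cutoff ξ) := by
  rw [hasSum_iff_tendsto_nat_of_nonneg (fun _ => annulus_nonneg _)]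
  have hs : ∀ n : ℕ, ∑ q ∈ Finset.range n, annulus ((2 : ℝ) ^ (-(q : ℤ)) • ξ) =
      cutoff ((2 : ℝ) ^ (-(n : ℤ)) • ξ) - cutoff ξ := by
    intro n
    induction n with
    | zero => simp
    | succ n ih =>
      rw [Finset.sum_range_succ, ih, annulus, smul_smul]
      have : (2 : ℝ)⁻¹ * 2 ^ (-(n : ℤ)) = 2 ^ (-((n + 1 : ℕ) : ℤ)) := by
        rw [← zpow_neg_one, ← zpow_add₀ (by norm_num)]
        congr 1
        push_cast
        ring
      rw [this]
      ring
  simp_rw [hs]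
  have hl : Filter.Tendsto (fun n : ℕ => (2 : ℝ) ^ (-(n : ℤ)) • ξ) Filter.atTop (nhds 0) := by
    have h0 : Filter.Tendsto (fun n : ℕ => (2 : ℝ)⁻¹ ^ n) Filter.atTop (nhds 0) :=
      tendsto_pow_atTop_nhds_zero_of_lt_one (by norm_num) (by norm_num)
    simpa using h0.smul_const ξ
  have h1 := (cutoff_smooth.continuous.tendsto 0).comp hl
  rw [cutoff_one (ξ := 0) (by norm_num)] at h1
  exact h1.sub_const _

theorem annulus_hasSum_neg {ξ : E3} (hξ : ξ ≠ 0) :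
    HasSum (fun n : ℕ => annulus ((2 : ℝ) ^ (n + 1) • ξ)) (cutoff ξ) := by
  rw [hasSum_iff_tendsto_nat_of_nonneg (fun _ => annulus_nonneg _)]
  have hs : ∀ n : ℕ, ∑ q ∈ Finset.range n, annulus ((2 : ℝ) ^ (q + 1) • ξ) =
      cutoff ξ - cutoff ((2 : ℝ) ^ n • ξ) := by
    intro n
    induction n with
    | zero => simp
    | succ n ih =>
      rw [Finset.sum_range_succ, ih, annulus, smul_smul]
      have : (2 : ℝ)⁻¹ * 2 ^ (n + 1) = 2 ^ n := by
        rw [pow_succ]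
        ring
      rw [this]
      ring
  simp_rw [hs]
  apply tendsto_const_nhds.congr'
  have hp : 0 < ‖ξ‖ := norm_pos_iff.2 hξ
  have hl : Filter.Tendsto (fun n : ℕ => (2 : ℝ) ^ n * ‖ξ‖) Filter.atTop Filter.atTop :=
    (tendsto_pow_atTop_atTop_of_one_lt (by norm_num)).atTop_mul_const hp
  filter_upwards [hl.eventually_ge_atTop (4 / 3)] with n hn
  rw [cutoff_zero (ξ := (2 : ℝ) ^ n • ξ) (by rw [norm_smul]; simpa using hn), sub_zero]

/-- Dyadic partitions of unity exist. -/
theorem DyadicPartition.nonempty : Nonempty DyadicPartition := by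
  have h0 : tsupport annulus ⊆ {ξ | 3 / 4 ≤ ‖ξ‖ ∧ ‖ξ‖ ≤ 8 / 3} := by
    simpa using tsupport_annulus 0
  refine ⟨{
    χ := cutoff
    φ := annulus
    χ_smooth := cutoff_smooth
    φ_smooth := (cutoff_smooth.comp (contDiff_const_smul _)).sub cutoff_smooth
    χ_compact := ?_
    φ_compact := ?_
    φ_away := ?_
    χ_nonneg := fun _ => Real.smoothTransition.nonneg _
    φ_nonneg := annulus_nonneg
    χ_radial := ?_
    φ_radial := ?_
    sum_inhom := annulus_hasSum_nonneg
    sum_hom := ?_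
    φ_disjoint := ?_
    χ_disjoint := ?_ }⟩
  · refine (isCompact_closedBall (0 : E3) (4 / 3)).of_isClosed_subset (isClosed_tsupport _) ?_
    intro ξ h
    simpa using tsupport_cutoff h
  · refine (isCompact_closedBall (0 : E3) (8 / 3)).of_isClosed_subset (isClosed_tsupport _) ?_
    intro ξ h
    simpa using (h0 h).2
  · intro h
    have := (h0 h).1
    norm_num at this
  · intro ξ η h
    simp only [cutoff, h]
  · intro ξ η h
    simp only [annulus, cutoff, norm_smul, h]
  · intro ξ hξ
    have h1 : HasSum (fun n : ℕ => annulus ((2 : ℝ) ^ (-(-((n : ℤ) + 1))) • ξ)) (cutoff ξ) := by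
      convert annulus_hasSum_neg hξ using 4 with n
      rw [neg_neg, ← zpow_natCast]
      push_cast
      rfl
    have h2 := HasSum.of_nat_of_neg_add_one
      (f := fun q : ℤ => annulus ((2 : ℝ) ^ (-q) • ξ)) (annulus_hasSum_nonneg ξ) h1
    simpa using h2
  · intro j q h
    rcases le_abs.1 h with h | h
    · exact (annulus_disjoint (by linarith)).symm
    · exact annulus_disjoint (by linarith)
  · intro q hq
    rw [Set.disjoint_left]
    intro ξ h1 h2
    have h1 : ‖ξ‖ ≤ 4 / 3 := tsupport_cutoff h1
    have h2 := (tsupport_annulus q h2).1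
    have h3 : (2 : ℝ) ^ (1 : ℤ) ≤ 2 ^ q := zpow_le_zpow_right₀ (by norm_num) hq
    norm_num at h3
    linarith

/-- The inverse Fourier transform of a real radial symbol `m`, as a real function: it is
real-valued because `m` is real and even. -/
def kernel (m : E3 → ℝ) (x : E3) : ℝ :=
  (𝓕⁻ (fun ξ : E3 => (m ξ : ℂ)) x).re

/-- The nonhomogeneous dyadic block `Δ_q u` of a vector field: `Δ_q u = 2^{3q} h(2^q ·) ∗ u`
for `q ≥ 0` with `h = 𝓕⁻ φ`, `Δ_{-1} u = g ∗ u` with `g = 𝓕⁻ χ`, and `Δ_q u = 0` for `q ≤ -2`. -/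
def block (P : DyadicPartition) (q : ℤ) (u : E3 → E3) : E3 → E3 :=
  if 0 ≤ q then
    (fun x => (2 : ℝ) ^ (3 * q) * kernel P.φ ((2 : ℝ) ^ q • x)) ⋆[ContinuousLinearMap.lsmul ℝ ℝ] u
  else if q = -1 then
    kernel P.χ ⋆[ContinuousLinearMap.lsmul ℝ ℝ] u
  else 0

/-- The Besov norm `‖u‖_{B^s_{p,r}} = ‖(2^{qs} ‖Δ_q u‖_{L^p})_q‖_{ℓ^r(ℤ)}`. -/
def besovNorm (P : DyadicPartition) (s : ℝ) (p r : ℝ≥0∞) (u : E3 → E3) : ℝ≥0∞ :=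
  eLpNorm (fun q : ℤ => (2 : ℝ≥0∞) ^ ((q : ℝ) * s) * eLpNorm (block P q u) p volume) r
    Measure.count

/-- The mixed norm `‖u‖_{L^ρ_t L^p}` over the time interval `(0, t)`. -/
def timeSpaceNorm {F : Type*} [NormedAddCommGroup F] (t : ℝ) (ρ p : ℝ≥0∞) (u : ℝ → E3 → F) :
    ℝ≥0∞ :=
  eLpNorm (fun τ : ℝ => eLpNorm (u τ) p volume) ρ (volume.restrict (Set.Ioo 0 t))

/-- The Chemin-Lerner norm
`‖u‖_{L̃^ρ_t B^s_{p,r}} = ‖(2^{qs} ‖Δ_q u‖_{L^ρ_t L^p})_q‖_{ℓ^r(ℤ)}`. -/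
def cheminLernerNorm (P : DyadicPartition) (t : ℝ) (ρ : ℝ≥0∞) (s : ℝ) (p r : ℝ≥0∞)
    (u : ℝ → E3 → E3) : ℝ≥0∞ :=
  eLpNorm
    (fun q : ℤ => (2 : ℝ≥0∞) ^ ((q : ℝ) * s) * timeSpaceNorm t ρ p (fun τ => block P q (u τ))) r
    Measure.count

/-! ### Axisymmetric vector fields -/

/-- The rotation of angle `α` around the vertical axis. -/
def rot (α : ℝ) (x : E3) : E3 :=
  !₂[Real.cos α * x 0 - Real.sin α * x 1, Real.sin α * x 0 + Real.cos α * x 1, x 2]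

/-- `R_{-α} (b (R_α x)) = b x` for every angle `α` and every point `x`. -/
def IsAxisymmetric (b : E3 → E3) : Prop :=
  ∀ α ∈ Set.Icc (0 : ℝ) (2 * Real.pi), ∀ x : E3, rot (-α) (b (rot α x)) = b x

/-- The distance `r` to the vertical axis. -/
def axisDist (x : E3) : ℝ := Real.sqrt (x 0 ^ 2 + x 1 ^ 2)

/-- The cylindrical basis vector `e_r = (cos θ, sin θ, 0)`. -/
def eR (x : E3) : E3 := !₂[x 0 / axisDist x, x 1 / axisDist x, 0]

/-- The cylindrical basis vector `e_θ = (-sin θ, cos θ, 0)`. -/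
def eTheta (x : E3) : E3 := !₂[-(x 1 / axisDist x), x 0 / axisDist x, 0]

/-- The radial component `b^r`. -/
def radialPart (b : E3 → E3) (x : E3) : ℝ := inner ℝ (b x) (eR x)

/-- The angular component `b^θ`. -/
def angularPart (b : E3 → E3) (x : E3) : ℝ := inner ℝ (b x) (eTheta x)

/-- The vertical component `b^z`. -/
def verticalPart (b : E3 → E3) (x : E3) : ℝ := b x 2

/-- Smooth axisymmetric vector fields of the form `b = b^θ(r, z) e_θ`. The components are tested
off the vertical axis, where the cylindrical basis is defined. -/
structure IsSmoothSwirl (b : E3 → E3) : Prop where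
  smooth : ContDiff ℝ ∞ b
  axisymmetric : IsAxisymmetric b
  radial_eq_zero : ∀ x, axisDist x ≠ 0 → radialPart b x = 0
  vertical_eq_zero : ∀ x, axisDist x ≠ 0 → verticalPart b x = 0

/-- The scalar function `b^θ / r`, defined off the vertical axis (a null set). -/
def swirlRatio (b : E3 → E3) (x : E3) : ℝ := angularPart b x / axisDist x

/-- The vector field `(b^θ / r) b`. -/
def swirlProduct (b : E3 → E3) (x : E3) : E3 := swirlRatio b x • b x

end AxisymmetricProduct

end

noncomputable section

namespace AxisymmetricProduct

open LineDeriv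

/-! ### Kernels of smooth radial symbols -/

/-! Let W = b^θ/r. The field is b = W·(-x₁, x₀, 0), so the nonzero components of W b are -u²/x₁ with
u = -b₀ = x₁W and u²/x₀ with u = b₁ = x₀W. In both cases u is odd in one coordinate xᵢ and satisfies
|u| ≤ ‖W‖_∞ |xᵢ|, which leaves a scalar problem: control the dyadic blocks of u²/xᵢ.

Let S_n be the low frequency cut-off at frequency 2^n. Two facts carry the proof. By
`abs_conv_dilation_le`, S_n u / xᵢ is bounded by C‖W‖_∞ uniformly in n; hence the increment of (S_n
u)²/xᵢ, which factors as (S_{n+1}u/xᵢ + S_n u/xᵢ)(S_{n+1}u - S_n u), costs one dyadic block of u. By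
`conv_sq_div_eq_zero`, (S_n u)²/xᵢ has no frequency far above 2^n: oddness gives S_n u = xᵢ ∫₀¹ (∂ᵢ
S_n u)(stretched by t) dt, and multiplying one coordinate by t ∈ [0,1] does not enlarge the
spectrum.

Telescoping u²/xᵢ = lim (S_n u)²/xᵢ then bounds its m-th block in L^p by ‖W‖_∞ times the sum of the
blocks of u of index n ≥ m - N, for every p ≥ 1 (`exists_eLpNorm_block_sq_div_le`). Such tails are
summable against the weights 2^{qs} as soon as s > 0 (`exists_eLpNorm_count_le`), which gives both
estimates.

Since u may grow linearly, spectral support is expressed by vanishing convolutions with rapidly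
decaying kernels, through Fubini, rather than by a Fourier transform of u. -/

/-- Smooth compactly supported radial symbols. -/
structure IsSymbol (m : E3 → ℝ) : Prop where
  smooth : ContDiff ℝ ∞ m
  compact : HasCompactSupport m
  radial : ∀ ξ η : E3, ‖ξ‖ = ‖η‖ → m ξ = m η

/-- Bounded continuous functions all of whose polynomial moments are absolutely integrable. -/
structure IsRapid (k : E3 → ℝ) : Prop where
  continuous : Continuous k
  integrable_weight : ∀ n : ℕ, Integrable (fun x => (1 + ‖x‖) ^ n * k x)
  bounded : ∃ B : ℝ, ∀ x, |k x| ≤ B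

theorem isRapid_re (f : SchwartzMap E3 ℂ) : IsRapid (fun x => (f x).re) := by
  have hc : Continuous fun x => (f x).re := Complex.continuous_re.comp f.continuous
  refine ⟨hc, fun n => ?_, SchwartzMap.seminorm ℝ 0 0 f, fun x =>
    (Complex.abs_re_le_norm _).trans (SchwartzMap.norm_le_seminorm ℝ f x)⟩
  have h : Integrable (fun x : E3 => (2 : ℝ) ^ (n - 1) * (‖x‖ ^ 0 * ‖f x‖ + ‖x‖ ^ n * ‖f x‖)) :=
    ((f.integrable_pow_mul volume 0).add (f.integrable_pow_mul volume n)).const_mul _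
  refine h.mono' (by fun_prop) (Filter.Eventually.of_forall fun x => ?_)
  have h1 : (1 + ‖x‖) ^ n ≤ 2 ^ (n - 1) * (1 ^ n + ‖x‖ ^ n) :=
    add_pow_le zero_le_one (norm_nonneg x) n
  have h2 : |(f x).re| ≤ ‖f x‖ := Complex.abs_re_le_norm _
  rw [norm_mul, norm_pow, Real.norm_of_nonneg (by positivity : 0 ≤ 1 + ‖x‖), Real.norm_eq_abs]
  calc (1 + ‖x‖) ^ n * |(f x).re| ≤ (2 ^ (n - 1) * (1 ^ n + ‖x‖ ^ n)) * ‖f x‖ := by gcongr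
    _ = _ := by ring

/-- A symbol as a complex Schwartz function. -/
def IsSymbol.schwartz {m : E3 → ℝ} (hm : IsSymbol m) : SchwartzMap E3 ℂ :=
  HasCompactSupport.toSchwartzMap (f := fun ξ => (m ξ : ℂ))
    (hm.compact.comp_left (g := Complex.ofReal) rfl) (Complex.ofRealCLM.contDiff.comp hm.smooth)

theorem IsSymbol.schwartz_apply {m : E3 → ℝ} (hm : IsSymbol m) (ξ : E3) :
    hm.schwartz ξ = (m ξ : ℂ) := rfl

theorem IsSymbol.fourierInv_isometry {m : E3 → ℝ} (hm : IsSymbol m) (A : E3 ≃ₗᵢ[ℝ] E3) (x : E3) :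
    𝓕⁻ (fun ξ : E3 => (m ξ : ℂ)) (A x) = 𝓕⁻ (fun ξ : E3 => (m ξ : ℂ)) x := by
  have e : (fun ξ : E3 => (m ξ : ℂ)) ∘ A = fun ξ => (m ξ : ℂ) := by
    ext ξ
    simp [hm.radial (A ξ) ξ (A.norm_map ξ)]
  rw [← Real.fourierInv_comp_linearIsometry, e]

/-- Conjugation sends x to -x because the symbol is real, and radiality under the isometry -1 undoes
this. The real part taken in `kernel` therefore loses nothing. -/
theorem IsSymbol.ofReal_kernel {m : E3 → ℝ} (hm : IsSymbol m) (x : E3) :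
    (kernel m x : ℂ) = 𝓕⁻ (fun ξ : E3 => (m ξ : ℂ)) x := by
  have h := hm.fourierInv_isometry (LinearIsometryEquiv.neg ℝ) x
  apply Complex.conj_eq_iff_re.1
  conv_rhs => rw [← h]
  rw [Real.fourierInv_eq, Real.fourierInv_eq, ← integral_conj]
  congr 1
  ext ξ
  simp [Circle.smul_def, ← Circle.coe_inv_eq_conj, AddChar.map_neg_eq_inv]

theorem IsSymbol.kernel_isometry {m : E3 → ℝ} (hm : IsSymbol m) (A : E3 ≃ₗᵢ[ℝ] E3) (x : E3) :
    kernel m (A x) = kernel m x := by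
  rw [kernel, hm.fourierInv_isometry, kernel]

theorem IsSymbol.fourierInv_schwartz_apply {m : E3 → ℝ} (hm : IsSymbol m) (x : E3) :
    𝓕⁻ hm.schwartz x = (kernel m x : ℂ) := by
  rw [hm.ofReal_kernel, SchwartzMap.fourierInv_coe]
  rfl

theorem IsSymbol.isRapid_kernel {m : E3 → ℝ} (hm : IsSymbol m) : IsRapid (kernel m) := by
  convert isRapid_re (𝓕⁻ hm.schwartz) using 2 with x
  rw [hm.fourierInv_schwartz_apply, Complex.ofReal_re]

theorem IsSymbol.fourier_kernel {m : E3 → ℝ} (hm : IsSymbol m) (ξ : E3) :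
    𝓕 (fun x => (kernel m x : ℂ)) ξ = (m ξ : ℂ) := by
  have h : (fun x => (kernel m x : ℂ)) = ⇑(𝓕⁻ hm.schwartz : SchwartzMap E3 ℂ) := by
    ext x
    rw [hm.fourierInv_schwartz_apply]
  rw [h, ← SchwartzMap.fourier_coe, FourierTransform.fourier_fourierInv_eq, hm.schwartz_apply]

theorem IsSymbol.integral_kernel {m : E3 → ℝ} (hm : IsSymbol m) : ∫ x, kernel m x = m 0 := by
  have h := hm.fourier_kernel 0
  rw [Real.fourier_eq] at h
  simp only [inner_zero_right, neg_zero, AddChar.map_zero_eq_one, one_smul] at h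
  rw [integral_complex_ofReal] at h
  exact_mod_cast h

/-- The derivative of the kernel of `m` along the `i`-th coordinate. -/
def kernelDeriv (i : Fin 3) (m : E3 → ℝ) (x : E3) : ℝ :=
  fderiv ℝ (kernel m) x (EuclideanSpace.single i 1)

theorem IsSymbol.contDiff_kernel {m : E3 → ℝ} (hm : IsSymbol m) : ContDiff ℝ ∞ (kernel m) := by
  have h : kernel m = fun x => Complex.reCLM (𝓕⁻ hm.schwartz x) := by
    ext x
    rw [hm.fourierInv_schwartz_apply, Complex.reCLM_apply, Complex.ofReal_re]
  rw [h]
  exact Complex.reCLM.contDiff.comp ((𝓕⁻ hm.schwartz : SchwartzMap E3 ℂ).smooth _)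

theorem IsSymbol.lineDerivOp_apply {m : E3 → ℝ} (hm : IsSymbol m) (i : Fin 3) (x : E3) :
    ∂_{(EuclideanSpace.single i (1 : ℝ) : E3)} (𝓕⁻ hm.schwartz) x = (kernelDeriv i m x : ℂ) := by
  have h : ⇑(𝓕⁻ hm.schwartz : SchwartzMap E3 ℂ) = fun x => Complex.ofRealCLM (kernel m x) := by
    ext x
    rw [hm.fourierInv_schwartz_apply, Complex.ofRealCLM_apply]
  rw [SchwartzMap.lineDerivOp_apply_eq_fderiv, h, kernelDeriv]
  have hd := (hm.contDiff_kernel.differentiable (by simp)) x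
  have hf : HasFDerivAt (fun x => Complex.ofRealCLM (kernel m x))
      (Complex.ofRealCLM.comp (fderiv ℝ (kernel m) x)) x :=
    Complex.ofRealCLM.hasFDerivAt.comp x hd.hasFDerivAt
  rw [hf.fderiv]
  rfl

theorem IsSymbol.isRapid_kernelDeriv {m : E3 → ℝ} (hm : IsSymbol m) (i : Fin 3) :
    IsRapid (kernelDeriv i m) := by
  convert isRapid_re (∂_{(EuclideanSpace.single i (1 : ℝ) : E3)} (𝓕⁻ hm.schwartz)) using 2 with x
  rw [hm.lineDerivOp_apply, Complex.ofReal_re]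

/-- The symbol of `kernelDeriv i m`. -/
def derivSymbol (i : Fin 3) (m : E3 → ℝ) (ξ : E3) : ℂ := 2 * Real.pi * Complex.I * (ξ i * m ξ)

theorem IsSymbol.derivSymbol_eq {m : E3 → ℝ} (hm : IsSymbol m) (i : Fin 3) :
    derivSymbol i m = ⇑((2 * Real.pi * Complex.I : ℂ) • SchwartzMap.smulLeftCLM ℂ
      (fun ξ : E3 => inner ℝ ξ (EuclideanSpace.single i (1 : ℝ) : E3)) hm.schwartz) := by
  ext ξ
  have : (fun ξ : E3 => inner ℝ ξ (EuclideanSpace.single i (1 : ℝ) : E3)).HasTemperateGrowth := by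
    fun_prop
  rw [smul_apply, SchwartzMap.smulLeftCLM_apply_apply this, hm.schwartz_apply]
  simp [derivSymbol, EuclideanSpace.inner_single_right]

theorem IsSymbol.ofReal_kernelDeriv {m : E3 → ℝ} (hm : IsSymbol m) (i : Fin 3) (x : E3) :
    (kernelDeriv i m x : ℂ) = 𝓕⁻ (derivSymbol i m) x := by
  rw [← hm.lineDerivOp_apply, SchwartzMap.lineDerivOp_fourierInv_eq, SchwartzMap.fourierInv_coe,
    hm.derivSymbol_eq]

theorem IsSymbol.integrable_derivSymbol {m : E3 → ℝ} (hm : IsSymbol m) (i : Fin 3) :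
    Integrable (derivSymbol i m) := by
  rw [hm.derivSymbol_eq]
  exact SchwartzMap.integrable _

theorem IsSymbol.integrable_ofReal {m : E3 → ℝ} (hm : IsSymbol m) :
    Integrable (fun ξ => (m ξ : ℂ)) :=
  hm.schwartz.integrable

theorem kernel_sub {m₁ m₂ : E3 → ℝ} (h₁ : IsSymbol m₁) (h₂ : IsSymbol m₂) (x : E3) :
    kernel (fun ξ => m₁ ξ - m₂ ξ) x = kernel m₁ x - kernel m₂ x := by
  simp only [kernel, Real.fourierInv_eq, ← Complex.sub_re]
  rw [← integral_sub]
  · simp [smul_sub]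
  · have := (Real.fourierIntegral_convergent_iff (-x)).2 h₁.integrable_ofReal
    simpa using this
  · have := (Real.fourierIntegral_convergent_iff (-x)).2 h₂.integrable_ofReal
    simpa using this

theorem IsSymbol.comp_smul {m : E3 → ℝ} (hm : IsSymbol m) {c : ℝ} (hc : c ≠ 0) :
    IsSymbol (fun ξ => m (c • ξ)) where
  smooth := hm.smooth.comp (contDiff_const_smul c)
  compact := hm.compact.comp_homeomorph (Homeomorph.smulOfNeZero c hc)
  radial ξ η h := hm.radial _ _ (by rw [norm_smul, norm_smul, h])

theorem kernel_comp_inv_smul (m : E3 → ℝ) {c : ℝ} (hc : 0 < c) (x : E3) :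
    kernel (fun ξ => m (c⁻¹ • ξ)) x = c ^ 3 * kernel m (c • x) := by
  have h := Measure.integral_comp_inv_smul (volume : Measure E3)
    (fun ξ => Real.fourierChar (inner ℝ ξ (c • x)) • (m ξ : ℂ)) c
  simp only [kernel, Real.fourierInv_eq]
  have e : ∀ ξ : E3, inner ℝ (c⁻¹ • ξ) (c • x) = inner ℝ ξ x := by
    intro ξ
    rw [inner_smul_left, inner_smul_right]
    simp [hc.ne']
  simp only [e] at h
  rw [h, finrank_euclideanSpace_fin, abs_of_pos (pow_pos hc 3), Complex.smul_re, smul_eq_mul]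

theorem IsSymbol.kernelDeriv_comp_inv_smul {m : E3 → ℝ} (hm : IsSymbol m) {c : ℝ} (hc : 0 < c)
    (i : Fin 3) (x : E3) :
    kernelDeriv i (fun ξ => m (c⁻¹ • ξ)) x = c ^ 4 * kernelDeriv i m (c • x) := by
  have h : kernel (fun ξ => m (c⁻¹ • ξ)) = fun x => c ^ 3 * kernel m (c • x) :=
    funext (kernel_comp_inv_smul m hc)
  have hd := (hm.contDiff_kernel.differentiable (by simp)) (c • x)
  have h1 : HasFDerivAt (fun x : E3 => c • x) (c • ContinuousLinearMap.id ℝ E3) x :=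
    (hasFDerivAt_id x).const_smul c
  have h2 := (hd.hasFDerivAt.comp x h1).const_mul (c ^ 3)
  rw [kernelDeriv, h]
  erw [h2.fderiv]
  simp [kernelDeriv]
  ring

/-! ### Stretching one coordinate -/

/-- The map multiplying the `i`-th coordinate by `t`. -/
def stretch (i : Fin 3) (t : ℝ) (x : E3) : E3 :=
  x + ((t - 1) * x i) • EuclideanSpace.single i 1

theorem stretch_apply_self (i : Fin 3) (t : ℝ) (x : E3) : stretch i t x i = t * x i := by
  simp [stretch]
  ring

theorem stretch_one (i : Fin 3) (x : E3) : stretch i 1 x = x := by simp [stretch]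

theorem continuous_stretch (i : Fin 3) : Continuous fun p : ℝ × E3 => stretch i p.1 p.2 := by
  unfold stretch
  fun_prop

/-- Self-adjointness: a stretch of the position variable becomes the same stretch of the frequency.
-/
theorem inner_stretch (i : Fin 3) (t : ℝ) (x y : E3) :
    inner ℝ x (stretch i t y) = inner ℝ (stretch i t x) y := by
  simp [stretch, inner_add_left, inner_add_right, inner_smul_left, inner_smul_right,
    EuclideanSpace.inner_single_right, EuclideanSpace.inner_single_left]
  ring

theorem norm_stretch_le (i : Fin 3) {t : ℝ} (ht : t ∈ Set.Icc (-1 : ℝ) 1) (x : E3) :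
    ‖stretch i t x‖ ≤ ‖x‖ := by
  rw [← sq_le_sq₀ (norm_nonneg _) (norm_nonneg _), EuclideanSpace.real_norm_sq_eq,
    EuclideanSpace.real_norm_sq_eq]
  apply Finset.sum_le_sum
  intro j _
  by_cases h : j = i
  · subst h
    rw [stretch_apply_self, mul_pow]
    have : t ^ 2 ≤ 1 := by nlinarith [ht.1, ht.2]
    nlinarith [sq_nonneg (x j)]
  · simp [stretch, h]

/-- The reflection changing the sign of the `i`-th coordinate. -/
def reflect (i : Fin 3) : E3 ≃ₗᵢ[ℝ] E3 :=
  LinearIsometryEquiv.piLpCongrRight 2 fun j =>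
    if j = i then LinearIsometryEquiv.neg ℝ else LinearIsometryEquiv.refl ℝ ℝ

theorem reflect_apply (i j : Fin 3) (x : E3) : reflect i x j = if j = i then -x j else x j := by
  simp [reflect]
  split_ifs <;> simp

/-! ### Spectral localization of products -/

/-- Expand both inverse transforms and integrate in u first. By `inner_stretch` the u-dependent
phases combine into the single frequency `stretch i t ξ + η`, so the inner integral is 𝓕 K at that
point up to a factor independent of u. -/
theorem integral_mul_fourierInv_mul_fourierInv_eq_zero {K m₁ m₂ : E3 → ℂ} (hK : Integrable K)
    (h₁ : Integrable m₁) (h₂ : Integrable m₂) (i : Fin 3) (t : ℝ) (x y w : E3)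
    (h : ∀ ξ η, m₁ ξ ≠ 0 → m₂ η ≠ 0 → 𝓕 K (stretch i t ξ + η) = 0) :
    ∫ u, K (x - u) * (𝓕⁻ m₁ (stretch i t u - y) * 𝓕⁻ m₂ (u - w)) = 0 := by
  have hKx : Integrable fun u => K (x - u) := hK.comp_sub_left x
  set F : E3 → E3 × E3 → ℂ := fun u z => K (x - u) *
    ((Real.fourierChar (inner ℝ z.1 (stretch i t u - y)) • m₁ z.1) *
      (Real.fourierChar (inner ℝ z.2 (u - w)) • m₂ z.2)) with hF
  have hcs : Continuous fun u => stretch i t u :=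
    (continuous_stretch i).comp (continuous_const.prodMk continuous_id)
  have hFi : Integrable (Function.uncurry F) (volume.prod (volume.prod volume)) := by
    have h0 := hKx.mul_prod (h₁.mul_prod h₂)
    refine h0.mono ?_ (Filter.Eventually.of_forall fun z => ?_)
    · have e : Function.uncurry F = fun z : E3 × E3 × E3 =>
          ((Real.fourierChar (inner ℝ z.2.1 (stretch i t z.1 - y)) : ℂ) *
            (Real.fourierChar (inner ℝ z.2.2 (z.1 - w)) : ℂ)) *
            (K (x - z.1) * (m₁ z.2.1 * m₂ z.2.2)) := by
        ext z
        simp only [hF, Function.uncurry, Circle.smul_def, smul_eq_mul]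
        ring
      rw [e]
      refine AEStronglyMeasurable.mul (Continuous.aestronglyMeasurable ?_) h0.aestronglyMeasurable
      have hc := hcs
      fun_prop
    · simp [hF, Function.uncurry]
  have hz : ∀ z : E3 × E3, ∫ u, F u z = 0 := by
    intro z
    by_cases hm : m₁ z.1 ≠ 0 ∧ m₂ z.2 ≠ 0
    · have e : ∀ u, F u z = (m₁ z.1 * m₂ z.2 *
          Real.fourierChar (inner ℝ (stretch i t z.1 + z.2) x - inner ℝ z.1 y - inner ℝ z.2 w)) *
          (Real.fourierChar (-inner ℝ (x - u) (stretch i t z.1 + z.2)) • K (x - u)) := by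
        intro u
        have e1 : inner ℝ z.1 (stretch i t u - y) + inner ℝ z.2 (u - w) =
            (inner ℝ (stretch i t z.1 + z.2) x - inner ℝ z.1 y - inner ℝ z.2 w) +
            -inner ℝ (x - u) (stretch i t z.1 + z.2) := by
          rw [real_inner_comm _ (x - u)]
          simp only [inner_sub_right, inner_stretch, inner_add_left]
          ring
        have e2 := congrArg (fun r => (Real.fourierChar r : ℂ)) e1
        simp only [AddChar.map_add_eq_mul, Circle.coe_mul] at e2
        simp only [hF, Circle.smul_def, smul_eq_mul]
        linear_combination (K (x - u) * m₁ z.1 * m₂ z.2) * e2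
      simp only [e]
      rw [integral_const_mul, integral_sub_left_eq_self
        (fun v => Real.fourierChar (-inner ℝ v (stretch i t z.1 + z.2)) • K v) volume x,
        ← Real.fourier_eq, h _ _ hm.1 hm.2, mul_zero]
    · have : ∀ u, F u z = 0 := by
        intro u
        simp only [hF]
        by_cases h1 : m₁ z.1 = 0
        · simp [h1]
        · have h2 : m₂ z.2 = 0 := by
            by_contra h2
            exact hm ⟨h1, h2⟩
          simp [h2]
      simp [this]
  calc ∫ u, K (x - u) * (𝓕⁻ m₁ (stretch i t u - y) * 𝓕⁻ m₂ (u - w))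
      = ∫ u, ∫ z, F u z ∂(volume.prod volume) := by
        congr 1
        ext u
        simp only [hF]
        rw [integral_const_mul, integral_prod_mul
          (fun ξ => Real.fourierChar (inner ℝ ξ (stretch i t u - y)) • m₁ ξ)
          (fun η => Real.fourierChar (inner ℝ η (u - w)) • m₂ η), Real.fourierInv_eq,
          Real.fourierInv_eq]
    _ = ∫ z, ∫ u, F u z ∂volume ∂(volume.prod volume) := integral_integral_swap hFi
    _ = 0 := by simp [hz]

/-! ### Convolution of rapidly decaying kernels with functions of linear growth -/

/-- Convolution of real functions. -/
def conv (k u : E3 → ℝ) (x : E3) : ℝ := ∫ y, k (x - y) * u y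

/-- Measurable functions growing at most linearly. -/
structure LinearGrowth (u : E3 → ℝ) : Prop where
  aestronglyMeasurable : AEStronglyMeasurable u volume
  bound : ∃ M : ℝ, ∀ y, |u y| ≤ M * (1 + ‖y‖)

theorem LinearGrowth.sub {u v : E3 → ℝ} (hu : LinearGrowth u) (hv : LinearGrowth v) :
    LinearGrowth fun y => u y - v y := by
  obtain ⟨M, hM⟩ := hu.bound
  obtain ⟨M', hM'⟩ := hv.bound
  refine ⟨hu.1.sub hv.1, M + M', fun y => ?_⟩
  have := abs_sub (u y) (v y)
  linarith [hM y, hM' y]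

theorem LinearGrowth.of_abs_le_coord {u : E3 → ℝ} (hu : AEStronglyMeasurable u volume) {M : ℝ}
    (hM : 0 ≤ M) {i : Fin 3} (h : ∀ y, |u y| ≤ M * |y i|) : LinearGrowth u := by
  refine ⟨hu, M, fun y => (h y).trans ?_⟩
  have : |y i| ≤ ‖y‖ := PiLp.norm_apply_le y i
  gcongr
  linarith

theorem IsRapid.integrable {k : E3 → ℝ} (hk : IsRapid k) : Integrable k := by
  simpa using hk.integrable_weight 0

theorem IsRapid.integrable_one_add_norm_mul {k : E3 → ℝ} (hk : IsRapid k) :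
    Integrable fun x => (1 + ‖x‖) * |k x| := by
  have h := (hk.integrable_weight 1).norm
  refine h.congr (Filter.Eventually.of_forall fun x => ?_)
  simp only [pow_one, norm_mul, Real.norm_eq_abs]
  rw [abs_of_nonneg (by positivity : 0 ≤ 1 + ‖x‖)]

theorem IsRapid.integrable_norm_mul {k : E3 → ℝ} (hk : IsRapid k) :
    Integrable fun x => ‖x‖ * |k x| := by
  refine (hk.integrable_one_add_norm_mul.sub hk.integrable.abs).congr
    (Filter.Eventually.of_forall fun x => ?_)
  simp only [Pi.sub_apply]
  ring

/-- Submultiplicativity of the weight turns linear growth in y into linear growth in x plus a moment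
of the kernel. -/
theorem one_add_norm_le (x y : E3) : 1 + ‖y‖ ≤ (1 + ‖x‖) * (1 + ‖x - y‖) := by
  have h : ‖y‖ ≤ ‖x‖ + ‖x - y‖ := by
    have := norm_sub_le x (x - y)
    simpa using this
  nlinarith [norm_nonneg x, norm_nonneg (x - y), mul_nonneg (norm_nonneg x) (norm_nonneg (x - y))]

theorem abs_mul_le_weight {k u : E3 → ℝ} {M : ℝ} (hM : ∀ y, |u y| ≤ M * (1 + ‖y‖)) (x y : E3) :
    |k (x - y) * u y| ≤ M * (1 + ‖x‖) * ((1 + ‖x - y‖) * |k (x - y)|) := by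
  have h0 : 0 ≤ M := by
    have := (abs_nonneg _).trans (hM 0)
    simpa using this
  rw [abs_mul]
  calc |k (x - y)| * |u y| ≤ |k (x - y)| * (M * ((1 + ‖x‖) * (1 + ‖x - y‖))) := by
        gcongr
        exact (hM y).trans (by gcongr; exact one_add_norm_le x y)
    _ = _ := by ring

theorem integrable_conv {k u : E3 → ℝ} (hk : IsRapid k) (hu : LinearGrowth u) (x : E3) :
    Integrable fun y => k (x - y) * u y := by
  obtain ⟨M, hM⟩ := hu.bound
  have h := ((hk.integrable_one_add_norm_mul.comp_sub_left x).const_mul (M * (1 + ‖x‖)))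
  refine h.mono' ?_ (Filter.Eventually.of_forall fun y => abs_mul_le_weight hM x y)
  have hc := hk.continuous
  exact (Continuous.aestronglyMeasurable (by fun_prop)).mul hu.1

theorem integral_abs_conv_le {k u : E3 → ℝ} (hk : IsRapid k) (hu : LinearGrowth u) {M : ℝ}
    (hM : ∀ y, |u y| ≤ M * (1 + ‖y‖)) (x : E3) :
    ∫ y, |k (x - y) * u y| ≤ M * (1 + ‖x‖) * ∫ z, (1 + ‖z‖) * |k z| := by
  rw [← integral_sub_left_eq_self (fun z => (1 + ‖z‖) * |k z|) volume x, ← integral_const_mul]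
  exact integral_mono (integrable_conv hk hu x).abs
    ((hk.integrable_one_add_norm_mul.comp_sub_left x).const_mul _) (abs_mul_le_weight hM x)

theorem conv_sub_right {k u v : E3 → ℝ} (hk : IsRapid k) (hu : LinearGrowth u)
    (hv : LinearGrowth v) (x : E3) :
    conv k (fun y => u y - v y) x = conv k u x - conv k v x := by
  rw [conv, conv, conv, ← integral_sub (integrable_conv hk hu x) (integrable_conv hk hv x)]
  simp only [mul_sub]

theorem aestronglyMeasurable_conv {k u : E3 → ℝ} (hk : Continuous k)
    (hu : AEStronglyMeasurable u volume) : AEStronglyMeasurable (conv k u) volume := by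
  have h : AEStronglyMeasurable (fun p : E3 × E3 => k (p.1 - p.2) * u p.2)
      (volume.prod volume) :=
    (Continuous.aestronglyMeasurable (by fun_prop)).mul hu.comp_snd
  exact h.integral_prod_right'

/-- From |y i| ≤ |x i| + ‖x - y‖: the first term meets the mass of the kernel, the second its first
moment. -/
theorem abs_conv_le {k u : E3 → ℝ} (hk : IsRapid k) (hu : LinearGrowth u) {M : ℝ} (hM : 0 ≤ M)
    {i : Fin 3} (h : ∀ y, |u y| ≤ M * |y i|) (x : E3) :
    |conv k u x| ≤ M * (|x i| * (∫ z, |k z|) + ∫ z, ‖z‖ * |k z|) := by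
  have hi := (hk.integrable.abs.const_mul |x i|).add hk.integrable_norm_mul
  rw [← integral_const_mul, ← integral_add (hk.integrable.abs.const_mul _) hk.integrable_norm_mul,
    ← integral_sub_left_eq_self (fun z => |x i| * |k z| + ‖z‖ * |k z|) volume x,
    ← integral_const_mul]
  refine (abs_integral_le_integral_abs).trans (integral_mono (integrable_conv hk hu x).abs
    ((hi.comp_sub_left x).const_mul M) fun y => ?_)
  have h1 : |y i| ≤ |x i| + ‖x - y‖ := by
    have h2 : |(x - y) i| ≤ ‖x - y‖ := PiLp.norm_apply_le (x - y) i
    have h3 := abs_sub (x i) ((x - y) i)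
    simp only [PiLp.sub_apply, sub_sub_cancel] at h2 h3
    linarith
  simp only [abs_mul]
  calc |k (x - y)| * |u y| ≤ |k (x - y)| * (M * (|x i| + ‖x - y‖)) := by
        gcongr
        exact (h y).trans (by gcongr)
    _ = _ := by ring

/-- Fubini for the pairing of `f` with a convolution, in the form of a vanishing criterion. -/
theorem integral_mul_conv_eq_zero {f k u : E3 → ℝ} (hf : Integrable fun v => (1 + ‖v‖) * f v)
    (hfm : AEStronglyMeasurable f volume) (hk : IsRapid k) (hu : LinearGrowth u) {A : E3 → E3}
    (hA : Continuous A) (hA' : ∀ v, ‖A v‖ ≤ ‖v‖) (h : ∀ w, ∫ v, f v * k (A v - w) = 0) :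
    ∫ v, f v * conv k u (A v) = 0 := by
  obtain ⟨M, hM⟩ := hu.bound
  have h0 : 0 ≤ M := by
    have := (abs_nonneg _).trans (hM 0)
    simpa using this
  set F : E3 → E3 → ℝ := fun v w => f v * (k (A v - w) * u w) with hF
  have hkc := hk.continuous
  have hFm : AEStronglyMeasurable (Function.uncurry F) (volume.prod volume) :=
    hfm.comp_fst.mul ((Continuous.aestronglyMeasurable (by fun_prop)).mul hu.1.comp_snd)
  have hFi : Integrable (Function.uncurry F) (volume.prod volume) := by
    rw [integrable_prod_iff hFm]
    refine ⟨Filter.Eventually.of_forall fun v => (integrable_conv hk hu (A v)).const_mul (f v), ?_⟩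
    refine (hf.norm.const_mul (M * ∫ z, (1 + ‖z‖) * |k z|)).mono'
      hFm.norm.integral_prod_right' (Filter.Eventually.of_forall fun v => ?_)
    have hI : 0 ≤ ∫ z, (1 + ‖z‖) * |k z| := integral_nonneg fun z => by positivity
    rw [Real.norm_of_nonneg (integral_nonneg fun _ => norm_nonneg _)]
    simp only [Function.uncurry, hF, norm_mul (f v), integral_const_mul]
    rw [norm_mul (1 + ‖v‖), Real.norm_of_nonneg (by positivity : 0 ≤ 1 + ‖v‖)]
    calc ‖f v‖ * ∫ w, ‖k (A v - w) * u w‖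
        ≤ ‖f v‖ * (M * (1 + ‖A v‖) * ∫ z, (1 + ‖z‖) * |k z|) := by
          gcongr
          exact integral_abs_conv_le hk hu hM (A v)
      _ ≤ ‖f v‖ * (M * (1 + ‖v‖) * ∫ z, (1 + ‖z‖) * |k z|) := by
          gcongr
          exact hA' v
      _ = _ := by ring
  calc ∫ v, f v * conv k u (A v) = ∫ v, ∫ w, F v w := by simp only [hF, conv, integral_const_mul]
    _ = ∫ w, ∫ v, F v w := integral_integral_swap hFi
    _ = 0 := by
      have : ∀ w, ∫ v, F v w = 0 := by
        intro w
        have e : ∀ v, F v w = (f v * k (A v - w)) * u w := fun v => by simp only [hF]; ring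
        simp only [e, integral_mul_const, h w, zero_mul]
      simp [this]

/-- Young's inequality with an integrable kernel. -/
theorem eLpNorm_conv_le {k u : E3 → ℝ} (hk : Continuous k) (hu : AEStronglyMeasurable u volume)
    {p : ℝ≥0∞} (hp : 1 ≤ p) :
    eLpNorm (conv k u) p volume ≤ (∫⁻ z, ‖k z‖ₑ) * eLpNorm u p volume := by
  have hpt : ∀ x, ‖conv k u x‖ₑ ≤ ∫⁻ y, ‖k (x - y)‖ₑ * ‖u y‖ₑ := fun x =>
    (enorm_integral_le_lintegral_enorm _).trans_eq (by simp only [enorm_mul])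
  have hshift : ∀ x, ∫⁻ y, ‖k (x - y)‖ₑ = ∫⁻ z, ‖k z‖ₑ := fun x =>
    lintegral_sub_left_eq_self (fun z => ‖k z‖ₑ) x
  have hkm : Measurable fun z => ‖k z‖ₑ := hk.measurable.enorm
  rcases eq_or_ne p ⊤ with rfl | hpt'
  · simp only [eLpNorm_exponent_top]
    refine eLpNormEssSup_le_of_ae_enorm_bound (Filter.Eventually.of_forall fun x => ?_)
    refine (hpt x).trans ?_
    rw [← hshift x, ← lintegral_mul_const'' _ (by fun_prop)]
    exact lintegral_mono_ae ((enorm_ae_le_eLpNormEssSup u volume).mono fun y hy => by gcongr)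
  · have hp0 : p ≠ 0 := (zero_lt_one.trans_le hp).ne'
    have hpr : 1 ≤ p.toReal := by
      rw [← ENNReal.toReal_one]
      exact (ENNReal.toReal_le_toReal ENNReal.one_ne_top hpt').2 hp
    have hpp : 0 < p.toReal := by linarith
    set I := ∫⁻ z, ‖k z‖ₑ with hI
    -- Jensen for the finite measure with density |k(x - ·)|, of total mass I: its L¹ norm is
    -- compared with its L^p norm.
    have hjen : ∀ x, (∫⁻ y, ‖k (x - y)‖ₑ * ‖u y‖ₑ) ^ p.toReal ≤
        I ^ (p.toReal - 1) * ∫⁻ y, ‖k (x - y)‖ₑ * ‖u y‖ₑ ^ p.toReal := by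
      intro x
      set ν : Measure E3 := volume.withDensity fun y => ‖k (x - y)‖ₑ with hν
      have hm : Measurable fun y => ‖k (x - y)‖ₑ := hkm.comp (measurable_const.sub measurable_id)
      have hac : ν ≪ volume := withDensity_absolutelyContinuous _ _
      have h := eLpNorm_le_eLpNorm_mul_rpow_measure_univ (μ := ν) hp (hu.mono_ac hac)
      have hfin : ∀ᵐ y, ‖k (x - y)‖ₑ < ⊤ := Filter.Eventually.of_forall fun y => enorm_lt_top
      rw [eLpNorm_one_eq_lintegral_enorm, eLpNorm_eq_lintegral_rpow_enorm_toReal hp0 hpt',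
        hν, lintegral_withDensity_eq_lintegral_mul_non_measurable _ hm hfin,
        lintegral_withDensity_eq_lintegral_mul_non_measurable _ hm hfin,
        withDensity_apply _ MeasurableSet.univ, Measure.restrict_univ, hshift x] at h
      have h2 := ENNReal.rpow_le_rpow h hpp.le
      rw [ENNReal.mul_rpow_of_nonneg _ _ hpp.le, ← ENNReal.rpow_mul, ← ENNReal.rpow_mul,
        one_div_mul_cancel hpp.ne', ENNReal.rpow_one] at h2
      refine h2.trans_eq ?_
      rw [mul_comm]
      congr 2
      simp
      field_simp
    rw [eLpNorm_eq_lintegral_rpow_enorm_toReal hp0 hpt',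
      eLpNorm_eq_lintegral_rpow_enorm_toReal hp0 hpt']
    have hum : AEMeasurable (fun y => ‖u y‖ₑ ^ p.toReal) volume := hu.enorm.pow_const _
    have hsw : ∫⁻ x, ∫⁻ y, ‖k (x - y)‖ₑ * ‖u y‖ₑ ^ p.toReal =
        I * ∫⁻ y, ‖u y‖ₑ ^ p.toReal := by
      rw [lintegral_lintegral_swap, ← lintegral_const_mul'' _ hum]
      · refine lintegral_congr fun y => ?_
        rw [lintegral_mul_const'' _ (by fun_prop),
          lintegral_sub_right_eq_self (fun z => ‖k z‖ₑ) y]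
      · exact AEMeasurable.mul (hkm.comp (measurable_fst.sub measurable_snd)).aemeasurable hum.comp_snd
    have hle : ∫⁻ x, ‖conv k u x‖ₑ ^ p.toReal ≤
        I ^ p.toReal * ∫⁻ y, ‖u y‖ₑ ^ p.toReal := by
      calc ∫⁻ x, ‖conv k u x‖ₑ ^ p.toReal
          ≤ ∫⁻ x, I ^ (p.toReal - 1) * ∫⁻ y, ‖k (x - y)‖ₑ * ‖u y‖ₑ ^ p.toReal :=
            lintegral_mono fun x => (ENNReal.rpow_le_rpow (hpt x) hpp.le).trans (hjen x)
        _ = I ^ (p.toReal - 1) * (I * ∫⁻ y, ‖u y‖ₑ ^ p.toReal) := by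
            rw [lintegral_const_mul'', hsw]
            have hm : AEMeasurable (fun q : E3 × E3 => ‖k (q.1 - q.2)‖ₑ * ‖u q.2‖ₑ ^ p.toReal)
                (volume.prod volume) :=
              AEMeasurable.mul (hkm.comp (measurable_fst.sub measurable_snd)).aemeasurable hum.comp_snd
            exact hm.lintegral_prod_right'
        _ = _ := by
            rw [← mul_assoc]
            congr 1
            nth_rewrite 2 [← ENNReal.rpow_one I]
            rw [← ENNReal.rpow_add_of_nonneg _ _ (by linarith) zero_le_one]
            congr 1
            ring
    calc (∫⁻ x, ‖conv k u x‖ₑ ^ p.toReal) ^ (1 / p.toReal)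
        ≤ (I ^ p.toReal * ∫⁻ y, ‖u y‖ₑ ^ p.toReal) ^ (1 / p.toReal) :=
          ENNReal.rpow_le_rpow hle (by positivity)
      _ = _ := by
          rw [ENNReal.mul_rpow_of_nonneg _ _ (by positivity), ← ENNReal.rpow_mul,
            mul_one_div_cancel hpp.ne', ENNReal.rpow_one]

/-! ### Fields that are odd in one coordinate -/

/-- Continuous functions that are odd in the `i`-th coordinate and bounded by `M |x i|`. -/
structure OddField (i : Fin 3) (M : ℝ) (u : E3 → ℝ) : Prop where
  continuous : Continuous u
  nonneg : 0 ≤ M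
  bound : ∀ y, |u y| ≤ M * |y i|
  odd : ∀ y, u (reflect i y) = -u y

theorem OddField.linearGrowth {i : Fin 3} {M : ℝ} {u : E3 → ℝ} (hu : OddField i M u) :
    LinearGrowth u :=
  .of_abs_le_coord hu.continuous.aestronglyMeasurable hu.nonneg hu.bound

/-- The point lies on the hyperplane xᵢ = 0, fixed by the reflection. The kernel is invariant under
it and u changes sign, so the convolution equals its own negative. -/
theorem conv_stretch_zero {i : Fin 3} {M : ℝ} {u m : E3 → ℝ} (hu : OddField i M u)
    (hm : IsSymbol m) (x : E3) : conv (kernel m) u (stretch i 0 x) = 0 := by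
  set z := stretch i 0 x with hz
  have hr : reflect i z = z := by
    ext j
    rw [reflect_apply]
    split_ifs with h
    · rw [h, hz, stretch_apply_self]
      simp
    · rfl
  have h : conv (kernel m) u z = -conv (kernel m) u z := by
    have h1 := (reflect i).measurePreserving.integral_comp
      (reflect i).toHomeomorph.measurableEmbedding (fun y => kernel m (z - y) * u y)
    rw [conv, ← integral_neg, ← h1]
    congr 1
    ext y
    rw [hu.odd, ← hm.kernel_isometry (reflect i) (z - y), map_sub, hr]
    ring
  linarith

/-- Fundamental theorem of calculus along the segment from the projection of x onto xᵢ = 0 (t = 0)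
to x itself (t = 1). -/
theorem integral_kernelDeriv_stretch {m : E3 → ℝ} (hm : IsSymbol m) (i : Fin 3) (x y : E3) :
    kernel m (x - y) - kernel m (stretch i 0 x - y) =
      ∫ t in Set.Ioc (0 : ℝ) 1, x i * kernelDeriv i m (stretch i t x - y) := by
  have hd : ∀ t : ℝ, HasDerivAt (fun t => kernel m (stretch i t x - y))
      (x i * kernelDeriv i m (stretch i t x - y)) t := by
    intro t
    have h1 : HasDerivAt (fun t : ℝ => stretch i t x - y)
        ((x i) • EuclideanSpace.single i (1 : ℝ)) t := by
      unfold stretch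
      have h2 : HasDerivAt (fun t : ℝ => (t - 1) * x i) (x i) t := by
        simpa using ((hasDerivAt_id t).sub_const 1).mul_const (x i)
      exact ((h2.smul_const (EuclideanSpace.single i (1 : ℝ))).const_add x).sub_const y
    have h3 := ((hm.contDiff_kernel.differentiable (by simp))
      (stretch i t x - y)).hasFDerivAt.comp_hasDerivAt t h1
    rw [map_smul, smul_eq_mul] at h3
    exact h3
  have hc := (hm.isRapid_kernelDeriv i).continuous
  have hs : Continuous fun t : ℝ => stretch i t x :=
    (continuous_stretch i).comp (continuous_id.prodMk continuous_const)
  rw [← intervalIntegral.integral_of_le zero_le_one,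
    intervalIntegral.integral_eq_sub_of_hasDerivAt (fun t _ => hd t)
      (Continuous.intervalIntegrable (by fun_prop) _ _), stretch_one]

theorem stronglyMeasurable_conv {k u : E3 → ℝ} (hk : Continuous k) (hu : Continuous u) :
    StronglyMeasurable (conv k u) := by
  have h : StronglyMeasurable (fun p : E3 × E3 => k (p.1 - p.2) * u p.2) :=
    Continuous.stronglyMeasurable (by fun_prop)
  exact h.integral_prod_right'

/-- Division by the `i`-th coordinate of the regularization of an odd field. -/
theorem conv_eq_coord_mul {i : Fin 3} {M : ℝ} {u m : E3 → ℝ} (hu : OddField i M u)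
    (hm : IsSymbol m) (x : E3) :
    conv (kernel m) u x =
      x i * ∫ t in Set.Ioc (0 : ℝ) 1, conv (kernelDeriv i m) u (stretch i t x) := by
  have hk := hm.isRapid_kernelDeriv i
  have hkc := hk.continuous
  have huc := hu.continuous
  have hs : Continuous fun t : ℝ => stretch i t x :=
    (continuous_stretch i).comp (continuous_id.prodMk continuous_const)
  obtain ⟨M', hM'⟩ := hu.linearGrowth.bound
  have h0 : 0 ≤ M' := by
    have := (abs_nonneg _).trans (hM' 0)
    simpa using this
  set F : E3 → ℝ → ℝ := fun y t => kernelDeriv i m (stretch i t x - y) * u y with hF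
  have hFi : Integrable (Function.uncurry F)
      (volume.prod (volume.restrict (Set.Ioc (0 : ℝ) 1))) := by
    have hFm : AEStronglyMeasurable (Function.uncurry F)
        (volume.prod (volume.restrict (Set.Ioc (0 : ℝ) 1))) :=
      Continuous.aestronglyMeasurable (by unfold Function.uncurry; fun_prop)
    rw [integrable_prod_iff' hFm]
    refine ⟨Filter.Eventually.of_forall fun t =>
      integrable_conv hk hu.linearGrowth (stretch i t x), ?_⟩
    have hFm' : AEStronglyMeasurable (fun t => ∫ y, ‖Function.uncurry F (y, t)‖)
        (volume.restrict (Set.Ioc (0 : ℝ) 1)) := hFm.norm.prod_swap.integral_prod_right'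
    refine (integrable_const (M' * (1 + ‖x‖) * ∫ z, (1 + ‖z‖) * |kernelDeriv i m z|)).mono' hFm' ?_
    refine (ae_restrict_mem measurableSet_Ioc).mono fun t ht => ?_
    rw [Real.norm_of_nonneg (integral_nonneg fun _ => norm_nonneg _)]
    have hle := integral_abs_conv_le hk hu.linearGrowth hM' (stretch i t x)
    refine le_trans hle ?_
    have hn := norm_stretch_le i ⟨by linarith [ht.1], ht.2⟩ x
    have hI : 0 ≤ ∫ z, (1 + ‖z‖) * |kernelDeriv i m z| := integral_nonneg fun z => by positivity
    exact mul_le_mul_of_nonneg_right (mul_le_mul_of_nonneg_left (by linarith) h0) hI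
  -- Oddness allows subtracting the value on xᵢ = 0; the derivative then falls on the kernel, so u
  -- need not be differentiated.
  calc conv (kernel m) u x = conv (kernel m) u x - conv (kernel m) u (stretch i 0 x) := by
        rw [conv_stretch_zero hu hm, sub_zero]
    _ = ∫ y, (kernel m (x - y) - kernel m (stretch i 0 x - y)) * u y := by
        rw [conv, conv, ← integral_sub (integrable_conv hm.isRapid_kernel hu.linearGrowth _)
          (integrable_conv hm.isRapid_kernel hu.linearGrowth _)]
        simp only [sub_mul]
    _ = ∫ y, x i * ∫ t in Set.Ioc (0 : ℝ) 1, F y t := by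
        congr 1
        ext y
        rw [integral_kernelDeriv_stretch hm, integral_const_mul, mul_assoc, ← integral_mul_const]
    _ = x i * ∫ t in Set.Ioc (0 : ℝ) 1, ∫ y, F y t := by
        rw [integral_const_mul, integral_integral_swap hFi]

/-! ### Bounds uniform in the frequency scale -/

theorem integral_pow_mul_comp_smul (f : E3 → ℝ) {c : ℝ} (hc : 0 < c) :
    ∫ z, c ^ 3 * f (c • z) = ∫ z, f z := by
  rw [integral_const_mul, Measure.integral_comp_smul, finrank_euclideanSpace_fin,
    abs_of_pos (by positivity), smul_eq_mul, ← mul_assoc, mul_inv_cancel₀ (by positivity), one_mul]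

/-- A scale invariant constant attached to a symbol and a coordinate. -/
def momentConst (i : Fin 3) (m : E3 → ℝ) : ℝ :=
  (∫ z, |kernel m z|) + (∫ z, ‖z‖ * |kernel m z|) +
    ((∫ z, |kernelDeriv i m z|) + ∫ z, ‖z‖ * |kernelDeriv i m z|)

theorem momentConst_nonneg (i : Fin 3) (m : E3 → ℝ) : 0 ≤ momentConst i m := by
  unfold momentConst
  have h1 : 0 ≤ ∫ z, |kernel m z| := integral_nonneg fun z => by positivity
  have h2 : 0 ≤ ∫ z, ‖z‖ * |kernel m z| := integral_nonneg fun z => by positivity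
  have h3 : 0 ≤ ∫ z, |kernelDeriv i m z| := integral_nonneg fun z => by positivity
  have h4 : 0 ≤ ∫ z, ‖z‖ * |kernelDeriv i m z| := integral_nonneg fun z => by positivity
  positivity

/-- Regularizations of an odd field are bounded by the `i`-th coordinate, uniformly in the
scale. -/
theorem abs_conv_dilation_le {i : Fin 3} {M : ℝ} {u m : E3 → ℝ} (hu : OddField i M u)
    (hm : IsSymbol m) {c : ℝ} (hc : 0 < c) (x : E3) :
    |conv (kernel fun ξ => m (c⁻¹ • ξ)) u x| ≤ momentConst i m * M * |x i| := by
  set m' : E3 → ℝ := fun ξ => m (c⁻¹ • ξ) with hm'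
  have hs : IsSymbol m' := hm.comp_smul (inv_ne_zero hc.ne')
  have hM := hu.nonneg
  have h1 : 0 ≤ ∫ z, |kernel m z| := integral_nonneg fun z => by positivity
  have h2 : 0 ≤ ∫ z, ‖z‖ * |kernel m z| := integral_nonneg fun z => by positivity
  have h3 : 0 ≤ ∫ z, |kernelDeriv i m z| := integral_nonneg fun z => by positivity
  have h4 : 0 ≤ ∫ z, ‖z‖ * |kernelDeriv i m z| := integral_nonneg fun z => by positivity
  have e1 : ∫ z, |kernel m' z| = ∫ z, |kernel m z| := by
    rw [← integral_pow_mul_comp_smul (fun z => |kernel m z|) hc]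
    congr 1
    ext z
    rw [kernel_comp_inv_smul m hc, abs_mul, abs_of_pos (by positivity : 0 < c ^ 3)]
  have e2 : ∫ z, ‖z‖ * |kernel m' z| = c⁻¹ * ∫ z, ‖z‖ * |kernel m z| := by
    rw [← integral_pow_mul_comp_smul (fun z => ‖z‖ * |kernel m z|) hc, ← integral_const_mul]
    congr 1
    ext z
    rw [kernel_comp_inv_smul m hc, abs_mul, abs_of_pos (by positivity : 0 < c ^ 3), norm_smul,
      Real.norm_of_nonneg hc.le]
    field_simp
  have e3 : ∫ z, |kernelDeriv i m' z| = c * ∫ z, |kernelDeriv i m z| := by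
    rw [← integral_pow_mul_comp_smul (fun z => |kernelDeriv i m z|) hc, ← integral_const_mul]
    congr 1
    ext z
    rw [hm.kernelDeriv_comp_inv_smul hc, abs_mul, abs_of_pos (by positivity : 0 < c ^ 4)]
    ring
  have e4 : ∫ z, ‖z‖ * |kernelDeriv i m' z| = ∫ z, ‖z‖ * |kernelDeriv i m z| := by
    rw [← integral_pow_mul_comp_smul (fun z => ‖z‖ * |kernelDeriv i m z|) hc]
    congr 1
    ext z
    rw [hm.kernelDeriv_comp_inv_smul hc, abs_mul, abs_of_pos (by positivity : 0 < c ^ 4),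
      norm_smul, Real.norm_of_nonneg hc.le]
    ring
  -- Far from the hyperplane, the first moment, of size c⁻¹, is absorbed by |x i|. Near it,
  -- `conv_eq_coord_mul` extracts the factor x i, and the mass of the differentiated kernel, of size
  -- c, is compensated by c|x i| ≤ 1.
  rcases le_total c⁻¹ |x i| with h | h
  · have hb := abs_conv_le hs.isRapid_kernel hu.linearGrowth hM hu.bound x
    rw [e1, e2] at hb
    calc _ ≤ _ := hb
      _ ≤ M * (|x i| * (∫ z, |kernel m z|) + |x i| * ∫ z, ‖z‖ * |kernel m z|) := by gcongr
      _ = ((∫ z, |kernel m z|) + ∫ z, ‖z‖ * |kernel m z|) * M * |x i| := by ring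
      _ ≤ _ := by
        have hle : (∫ z, |kernel m z|) + ∫ z, ‖z‖ * |kernel m z| ≤ momentConst i m := by
          unfold momentConst
          linarith
        gcongr
  · have hb : ∀ t ∈ Set.Ioc (0 : ℝ) 1, ‖conv (kernelDeriv i m') u (stretch i t x)‖ ≤
        M * ((∫ z, |kernelDeriv i m z|) + ∫ z, ‖z‖ * |kernelDeriv i m z|) := by
      intro t ht
      refine (abs_conv_le (hs.isRapid_kernelDeriv i) hu.linearGrowth hM hu.bound _).trans ?_
      rw [e3, e4, stretch_apply_self, abs_mul, abs_of_pos ht.1, ← mul_assoc]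
      have : t * |x i| * c ≤ 1 := by
        calc t * |x i| * c ≤ 1 * c⁻¹ * c := by
              gcongr
              exact ht.2
          _ = 1 := by field_simp
      gcongr
      nlinarith
    have hI := norm_setIntegral_le_of_norm_le_const (μ := volume) (by simp) hb
    rw [conv_eq_coord_mul hu hs, abs_mul]
    simp only [Real.norm_eq_abs, measureReal_def, Real.volume_Ioc, sub_zero, ENNReal.ofReal_one,
      ENNReal.toReal_one, mul_one] at hI
    calc _ ≤ |x i| * (M * ((∫ z, |kernelDeriv i m z|) + ∫ z, ‖z‖ * |kernelDeriv i m z|)) := by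
          gcongr
      _ = ((∫ z, |kernelDeriv i m z|) + ∫ z, ‖z‖ * |kernelDeriv i m z|) * M * |x i| := by ring
      _ ≤ _ := by
        have hle : (∫ z, |kernelDeriv i m z|) + ∫ z, ‖z‖ * |kernelDeriv i m z| ≤
            momentConst i m := by
          unfold momentConst
          linarith
        gcongr

/-! ### Growth bounds and spectral localization of (S_n u)²/xᵢ -/

theorem IsRapid.integrable_pow_mul_comp_sub {k : E3 → ℝ} (hk : IsRapid k) (n : ℕ) (x : E3) :
    Integrable fun v => (1 + ‖v‖) ^ n * k (x - v) := by
  have hc := hk.continuous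
  refine (((hk.integrable_weight n).comp_sub_left x).norm.const_mul ((1 + ‖x‖) ^ n)).mono'
    (Continuous.aestronglyMeasurable (by fun_prop)) (Filter.Eventually.of_forall fun v => ?_)
  rw [norm_mul, norm_mul, norm_pow, norm_pow, Real.norm_of_nonneg (by positivity : 0 ≤ 1 + ‖v‖),
    Real.norm_of_nonneg (by positivity : 0 ≤ 1 + ‖x - v‖), ← mul_assoc, ← mul_pow]
  gcongr
  exact one_add_norm_le x v

theorem exists_abs_conv_le {k u : E3 → ℝ} (hk : IsRapid k) (hu : LinearGrowth u) :
    ∃ B : ℝ, 0 ≤ B ∧ ∀ x, |conv k u x| ≤ B * (1 + ‖x‖) := by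
  obtain ⟨M, hM⟩ := hu.bound
  have h0 : 0 ≤ M := by
    have := (abs_nonneg _).trans (hM 0)
    simpa using this
  have hI : 0 ≤ ∫ z, (1 + ‖z‖) * |k z| := integral_nonneg fun z => by positivity
  refine ⟨M * ∫ z, (1 + ‖z‖) * |k z|, by positivity, fun x => ?_⟩
  exact (abs_integral_le_integral_abs.trans (integral_abs_conv_le hk hu hM x)).trans_eq (by ring)

/-- The square of the regularization divided by the coordinate is spectrally localized. -/
theorem conv_sq_div_eq_zero {i : Fin 3} {M : ℝ} {u m μ : E3 → ℝ} (hu : OddField i M u)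
    (hm : IsSymbol m) (hμ : IsSymbol μ)
    (h : ∀ t ∈ Set.Icc (0 : ℝ) 1, ∀ ξ η, m ξ ≠ 0 → m η ≠ 0 → μ (stretch i t ξ + η) = 0) (x : E3) :
    conv (kernel μ) (fun v => conv (kernel m) u v ^ 2 / v i) x = 0 := by
  have hK := hμ.isRapid_kernel
  have hk := hm.isRapid_kernel
  have hd := hm.isRapid_kernelDeriv i
  have hKc := hK.continuous
  have hdc := hd.continuous
  have hst : ∀ t : ℝ, Continuous fun v : E3 => stretch i t v := fun t =>
    (continuous_stretch i).comp (continuous_const.prodMk continuous_id)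
  have hSm := stronglyMeasurable_conv hk.continuous hu.continuous
  have hDm := stronglyMeasurable_conv hd.continuous hu.continuous
  obtain ⟨B, hB0, hB⟩ := exists_abs_conv_le hk hu.linearGrowth
  obtain ⟨B', hB0', hB'⟩ := exists_abs_conv_le hd hu.linearGrowth
  set S := conv (kernel m) u with hS
  set D := conv (kernelDeriv i m) u with hD
  have hKm : StronglyMeasurable fun v => kernel μ (x - v) :=
    Continuous.stronglyMeasurable (by fun_prop)
  -- Also valid on v i = 0: there S v = 0 by the division formula, and division by zero gives 0.
  have hid : ∀ v, S v ^ 2 / v i = S v * ∫ t in Set.Ioc (0 : ℝ) 1, D (stretch i t v) := by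
    intro v
    have hv := conv_eq_coord_mul hu hm v
    rw [← hS, ← hD] at hv
    by_cases h0 : v i = 0
    · simp [h0, hv]
    · rw [hv]
      field_simp
  set F : E3 → ℝ → ℝ := fun v t => kernel μ (x - v) * S v * D (stretch i t v) with hF
  have hFi : Integrable (Function.uncurry F)
      (volume.prod (volume.restrict (Set.Ioc (0 : ℝ) 1))) := by
    -- S and D both grow at most linearly, hence the second power of the weight.
    have hI := ((hK.integrable_pow_mul_comp_sub 2 x).norm.const_mul (B * B')).mul_prod
      (integrable_const (μ := volume.restrict (Set.Ioc (0 : ℝ) 1)) (1 : ℝ))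
    refine hI.mono' ?_ ?_
    · refine StronglyMeasurable.aestronglyMeasurable ?_
      have hc : Continuous fun p : E3 × ℝ => stretch i p.2 p.1 :=
        (continuous_stretch i).comp continuous_swap
      exact ((hKm.mul hSm).comp_measurable measurable_fst).mul (hDm.comp_measurable hc.measurable)
    · have hae : ∀ᵐ p : E3 × ℝ ∂(volume.prod (volume.restrict (Set.Ioc (0 : ℝ) 1))),
          p.2 ∈ Set.Ioc (0 : ℝ) 1 :=
        Measure.quasiMeasurePreserving_snd.ae (ae_restrict_mem measurableSet_Ioc)
      refine hae.mono fun p hp => ?_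
      have hn := norm_stretch_le i ⟨by linarith [hp.1], hp.2⟩ p.1
      have h1 := hB p.1
      have h2 : |D (stretch i p.2 p.1)| ≤ B' * (1 + ‖p.1‖) := (hB' _).trans (by gcongr)
      simp only [Function.uncurry, hF, norm_mul, mul_one, norm_pow, Real.norm_eq_abs]
      rw [abs_of_nonneg (by positivity : 0 ≤ 1 + ‖p.1‖)]
      calc |kernel μ (x - p.1)| * |S p.1| * |D (stretch i p.2 p.1)|
          ≤ |kernel μ (x - p.1)| * (B * (1 + ‖p.1‖)) * (B' * (1 + ‖p.1‖)) := by gcongr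
        _ = _ := by ring
  -- For fixed t, the vanishing criterion is applied twice: once to unfold D, evaluated at the
  -- stretched point, and once to unfold S. What remains is a triple product of kernels without u,
  -- settled by the frequency condition.
  have hz : ∀ t ∈ Set.Ioc (0 : ℝ) 1, ∫ v, F v t = 0 := by
    intro t ht
    have ht' : t ∈ Set.Icc (-1 : ℝ) 1 := ⟨by linarith [ht.1], ht.2⟩
    have hsc := hst t
    refine integral_mul_conv_eq_zero (f := fun v => kernel μ (x - v) * S v) ?_
      (hKm.mul hSm).aestronglyMeasurable hd hu.linearGrowth hsc (norm_stretch_le i ht')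
      fun w => ?_
    · refine ((hK.integrable_pow_mul_comp_sub 2 x).norm.const_mul B).mono' ?_
        (Filter.Eventually.of_forall fun v => ?_)
      · exact (Continuous.aestronglyMeasurable (by fun_prop)).mul
          (hKm.mul hSm).aestronglyMeasurable
      · simp only [norm_mul, norm_pow, Real.norm_eq_abs]
        rw [abs_of_nonneg (by positivity : 0 ≤ 1 + ‖v‖)]
        calc (1 + ‖v‖) * (|kernel μ (x - v)| * |S v|)
            ≤ (1 + ‖v‖) * (|kernel μ (x - v)| * (B * (1 + ‖v‖))) := by
              gcongr
              exact hB v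
          _ = _ := by ring
    · obtain ⟨Q, hQ⟩ := hd.bounded
      have e : ∀ v, kernel μ (x - v) * S v * kernelDeriv i m (stretch i t v - w) =
          kernel μ (x - v) * kernelDeriv i m (stretch i t v - w) * S v := fun v => by ring
      simp only [e]
      refine integral_mul_conv_eq_zero
        (f := fun v => kernel μ (x - v) * kernelDeriv i m (stretch i t v - w)) (A := id) ?_
        (Continuous.aestronglyMeasurable (by fun_prop)) hk hu.linearGrowth continuous_id
        (fun v => le_rfl) fun w' => ?_
      · refine ((hK.integrable_pow_mul_comp_sub 1 x).norm.const_mul Q).mono'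
          (Continuous.aestronglyMeasurable (by fun_prop)) (Filter.Eventually.of_forall fun v => ?_)
        simp only [norm_mul, Real.norm_eq_abs, pow_one]
        rw [abs_of_nonneg (by positivity : 0 ≤ 1 + ‖v‖)]
        calc (1 + ‖v‖) * (|kernel μ (x - v)| * |kernelDeriv i m (stretch i t v - w)|)
            ≤ (1 + ‖v‖) * (|kernel μ (x - v)| * Q) := by
              gcongr
              exact hQ _
          _ = _ := by ring
      · have hv := integral_mul_fourierInv_mul_fourierInv_eq_zero
          (K := fun v => (kernel μ v : ℂ)) hK.integrable.ofReal (hm.integrable_derivSymbol i)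
          hm.integrable_ofReal i t x w w' (fun ξ η h1 h2 => by
            rw [hμ.fourier_kernel, h t ⟨ht.1.le, ht.2⟩ ξ η ?_ ?_, Complex.ofReal_zero]
            · intro h0
              simp [derivSymbol, h0] at h1
            · intro h0
              simp [h0] at h2)
        simp only [← hm.ofReal_kernelDeriv, ← hm.ofReal_kernel, ← Complex.ofReal_mul] at hv
        rw [integral_complex_ofReal] at hv
        have := Complex.ofReal_eq_zero.1 hv
        rw [← this]
        congr 1
        ext v
        simp only [id]
        ring
  calc conv (kernel μ) (fun v => S v ^ 2 / v i) x = ∫ v, ∫ t in Set.Ioc (0 : ℝ) 1, F v t := by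
        simp only [conv, hid, hF, integral_const_mul, mul_assoc]
    _ = ∫ t in Set.Ioc (0 : ℝ) 1, ∫ v, F v t := integral_integral_swap hFi
    _ = 0 := setIntegral_eq_zero_of_forall_eq_zero hz

/-! ### Dyadic telescoping -/

/-- The symbol of the low frequency cut-off at frequency `2 ^ n`. -/
def lowSymbol (P : DyadicPartition) (n : ℕ) (ξ : E3) : ℝ := P.χ (((2 : ℝ) ^ n)⁻¹ • ξ)

/-- The symbol of the dyadic block of index `n - 1`. -/
def blockSymbol (P : DyadicPartition) : ℕ → E3 → ℝ
  | 0 => P.χ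
  | n + 1 => fun ξ => P.φ (((2 : ℝ) ^ n)⁻¹ • ξ)

theorem isSymbol_χ (P : DyadicPartition) : IsSymbol P.χ := ⟨P.χ_smooth, P.χ_compact, P.χ_radial⟩

theorem isSymbol_φ (P : DyadicPartition) : IsSymbol P.φ := ⟨P.φ_smooth, P.φ_compact, P.φ_radial⟩

theorem isSymbol_lowSymbol (P : DyadicPartition) (n : ℕ) : IsSymbol (lowSymbol P n) :=
  (isSymbol_χ P).comp_smul (by positivity)

theorem isSymbol_blockSymbol (P : DyadicPartition) : ∀ n, IsSymbol (blockSymbol P n)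
  | 0 => isSymbol_χ P
  | _ + 1 => (isSymbol_φ P).comp_smul (by positivity)

theorem blockSymbol_zero_eq (P : DyadicPartition) : blockSymbol P 0 = lowSymbol P 0 := by
  ext ξ
  simp [blockSymbol, lowSymbol]

/-- The partition identity at η with its term q = 0 removed has the same series as the identity at
η/2. -/
theorem φ_eq_χ_sub (P : DyadicPartition) (η : E3) : P.φ η = P.χ ((2 : ℝ)⁻¹ • η) - P.χ η := by
  have h1 := P.sum_inhom η
  have h2 := P.sum_inhom ((2 : ℝ)⁻¹ • η)
  have h3 := (hasSum_nat_add_iff' 1).2 h1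
  have e : (fun q : ℕ => P.φ ((2 : ℝ) ^ (-((q + 1 : ℕ) : ℤ)) • η)) =
      fun q : ℕ => P.φ ((2 : ℝ) ^ (-(q : ℤ)) • (2 : ℝ)⁻¹ • η) := by
    ext q
    rw [smul_smul, ← zpow_neg_one, ← zpow_add₀ (by norm_num)]
    congr 3
    push_cast
    ring
  rw [e] at h3
  have h4 := h2.unique h3
  simp only [Finset.range_one, Finset.sum_singleton, Nat.cast_zero, neg_zero, zpow_zero,
    one_smul] at h4
  linarith

theorem blockSymbol_succ_eq (P : DyadicPartition) (n : ℕ) :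
    blockSymbol P (n + 1) = fun ξ => lowSymbol P (n + 1) ξ - lowSymbol P n ξ := by
  ext ξ
  simp only [blockSymbol, lowSymbol]
  rw [φ_eq_χ_sub, smul_smul, pow_succ, mul_inv_rev]

theorem χ_zero (P : DyadicPartition) : P.χ 0 = 1 := by
  have h := P.sum_inhom 0
  have h0 : P.φ 0 = 0 := image_eq_zero_of_notMem_tsupport P.φ_away
  simp only [smul_zero, h0] at h
  have := h.unique hasSum_zero
  linarith

theorem exists_spectral_gap (P : DyadicPartition) (i : Fin 3) : ∃ N : ℕ, ∀ n m : ℕ, n + N < m →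
    ∀ t ∈ Set.Icc (0 : ℝ) 1, ∀ ξ η, lowSymbol P n ξ ≠ 0 → lowSymbol P n η ≠ 0 →
      blockSymbol P m (stretch i t ξ + η) = 0 := by
  obtain ⟨R, hR⟩ := P.χ_compact.isBounded.subset_closedBall (0 : E3)
  obtain ⟨ε, hε, hφ⟩ := Metric.isOpen_iff.1 (isClosed_tsupport P.φ).isOpen_compl 0 P.φ_away
  have hlow : ∀ n ξ, lowSymbol P n ξ ≠ 0 → ‖ξ‖ ≤ 2 ^ n * R := by
    intro n ξ h
    have h1 := hR (subset_tsupport _ h)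
    rw [mem_closedBall_zero_iff, norm_smul, norm_inv, norm_pow, Real.norm_ofNat] at h1
    rwa [inv_mul_le_iff₀ (by positivity)] at h1
  have hR0 : 0 ≤ R := by
    have h := hlow 0 0 (by simp [lowSymbol, χ_zero])
    simpa using h
  -- Two frequencies of size at most 2^n R add up to at most 2^(n+1) R, while φ vanishes on the ball
  -- of radius ε. N is chosen with 2^N ε > 2R; since block m lives at scale 2^(m-1), the gap is
  -- strict.
  obtain ⟨N, hN⟩ := pow_unbounded_of_one_lt (2 * R / ε) (by norm_num : (1 : ℝ) < 2)
  refine ⟨N, fun n m hm t ht ξ η hξ hη => ?_⟩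
  obtain ⟨k, rfl⟩ : ∃ k, m = n + N + k + 1 := ⟨m - (n + N) - 1, by omega⟩
  have h1 : ‖stretch i t ξ + η‖ ≤ 2 * (2 ^ n * R) := by
    have := norm_stretch_le i ⟨by linarith [ht.1], ht.2⟩ ξ
    linarith [norm_add_le (stretch i t ξ) η, hlow n ξ hξ, hlow n η hη]
  change P.φ (((2 : ℝ) ^ (n + N + k))⁻¹ • (stretch i t ξ + η)) = 0
  refine image_eq_zero_of_notMem_tsupport (hφ ?_)
  rw [mem_ball_zero_iff, norm_smul, norm_inv, norm_pow, Real.norm_ofNat,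
    inv_mul_lt_iff₀ (by positivity)]
  refine h1.trans_lt ?_
  rw [div_lt_iff₀ hε] at hN
  have hk : (1 : ℝ) ≤ 2 ^ k := one_le_pow₀ (by norm_num)
  have hn : (0 : ℝ) < 2 ^ n := by positivity
  calc 2 * (2 ^ n * R) = 2 ^ n * (2 * R) := by ring
    _ < 2 ^ n * (2 ^ N * ε) := by gcongr
    _ ≤ 2 ^ n * (2 ^ N * ε) * 2 ^ k := le_mul_of_one_le_right (by positivity) hk
    _ = _ := by ring

theorem lintegral_kernel_dilation {m : E3 → ℝ} (hm : IsSymbol m) {c : ℝ} (hc : 0 < c) :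
    ∫⁻ z, ‖kernel (fun ξ => m (c⁻¹ • ξ)) z‖ₑ = ∫⁻ z, ‖kernel m z‖ₑ := by
  rw [← ofReal_integral_norm_eq_lintegral_enorm
      (hm.comp_smul (inv_ne_zero hc.ne')).isRapid_kernel.integrable,
    ← ofReal_integral_norm_eq_lintegral_enorm hm.isRapid_kernel.integrable,
    ← integral_pow_mul_comp_smul (fun z => ‖kernel m z‖) hc]
  congr 2
  ext z
  rw [kernel_comp_inv_smul m hc, norm_mul, Real.norm_of_nonneg (by positivity : 0 ≤ c ^ 3)]

/-- All kernels of positive index are L¹-normalized dilates of the kernel of φ, so Young's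
inequality has one constant for all blocks. -/
theorem exists_lintegral_blockKernel_le (P : DyadicPartition) :
    ∃ B : ℝ≥0, ∀ m, ∫⁻ z, ‖kernel (blockSymbol P m) z‖ₑ ≤ B := by
  have h1 := (isSymbol_χ P).isRapid_kernel.integrable.hasFiniteIntegral.ne
  have h2 := (isSymbol_φ P).isRapid_kernel.integrable.hasFiniteIntegral.ne
  refine ⟨(∫⁻ z, ‖kernel P.χ z‖ₑ).toNNReal + (∫⁻ z, ‖kernel P.φ z‖ₑ).toNNReal, fun m => ?_⟩
  rw [ENNReal.coe_add, ENNReal.coe_toNNReal h1, ENNReal.coe_toNNReal h2]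
  cases m with
  | zero => exact le_self_add
  | succ n =>
    simp only [blockSymbol]
    rw [lintegral_kernel_dilation (isSymbol_φ P) (by positivity)]
    exact le_add_self

/-- Approximate identity: the kernel of χ has integral χ(0) = 1, and rescaling moves n into the
argument of u, where linear growth gives a dominating function. -/
theorem tendsto_conv_lowSymbol (P : DyadicPartition) {u : E3 → ℝ} (hu : LinearGrowth u)
    (huc : Continuous u) (x : E3) :
    Filter.Tendsto (fun n => conv (kernel (lowSymbol P n)) u x) Filter.atTop (nhds (u x)) := by
  have hk := (isSymbol_χ P).isRapid_kernel
  have hkc := hk.continuous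
  obtain ⟨M, hM⟩ := hu.bound
  have h0 : 0 ≤ M := by
    have := (abs_nonneg _).trans (hM 0)
    simpa using this
  have e : ∀ n : ℕ, conv (kernel (lowSymbol P n)) u x =
      ∫ z, kernel P.χ z * u (x - ((2 : ℝ) ^ n)⁻¹ • z) := by
    intro n
    have hc : (0 : ℝ) < 2 ^ n := by positivity
    rw [← integral_pow_mul_comp_smul (fun z => kernel P.χ z * u (x - ((2 : ℝ) ^ n)⁻¹ • z)) hc, conv,
      ← integral_sub_left_eq_self _ volume x]
    congr 1
    ext z
    rw [sub_sub_cancel, smul_smul, inv_mul_cancel₀ hc.ne', one_smul]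
    unfold lowSymbol
    rw [kernel_comp_inv_smul P.χ hc]
    ring
  have hlim : u x = ∫ z, kernel P.χ z * u x := by
    rw [integral_mul_const, (isSymbol_χ P).integral_kernel, χ_zero, one_mul]
  simp only [e]
  rw [hlim]
  refine tendsto_integral_of_dominated_convergence
    (fun z => M * (1 + ‖x‖) * ((1 + ‖z‖) * |kernel P.χ z|))
    (fun n => Continuous.aestronglyMeasurable (by fun_prop))
    (hk.integrable_one_add_norm_mul.const_mul _) (fun n => ?_) ?_
  · refine Filter.Eventually.of_forall fun z => ?_
    have hc : ((2 : ℝ) ^ n)⁻¹ ≤ 1 := inv_le_one_of_one_le₀ (one_le_pow₀ (by norm_num))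
    have h1 : ‖x - ((2 : ℝ) ^ n)⁻¹ • z‖ ≤ ‖x‖ + ‖z‖ := by
      refine (norm_sub_le _ _).trans ?_
      rw [norm_smul, Real.norm_of_nonneg (by positivity)]
      gcongr
      exact mul_le_of_le_one_left (norm_nonneg z) hc
    rw [norm_mul, Real.norm_eq_abs, Real.norm_eq_abs]
    calc |kernel P.χ z| * |u (x - ((2 : ℝ) ^ n)⁻¹ • z)|
        ≤ |kernel P.χ z| * (M * ((1 + ‖x‖) * (1 + ‖z‖))) := by
          gcongr
          refine (hM _).trans ?_
          gcongr
          nlinarith [mul_nonneg (norm_nonneg x) (norm_nonneg z)]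
      _ = _ := by ring
  · refine Filter.Eventually.of_forall fun z => ?_
    have hl : Filter.Tendsto (fun n : ℕ => ((2 : ℝ) ^ n)⁻¹) Filter.atTop (nhds 0) := by
      have := tendsto_pow_atTop_nhds_zero_of_lt_one (r := (2 : ℝ)⁻¹) (by norm_num) (by norm_num)
      simpa using this
    have h2 : Filter.Tendsto (fun n : ℕ => x - ((2 : ℝ) ^ n)⁻¹ • z) Filter.atTop (nhds x) := by
      simpa using (hl.smul_const z).const_sub x
    exact ((huc.tendsto x).comp h2).const_mul _

/-- The square of the low frequency part of `u`, divided by the `i`-th coordinate. -/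
def lowSquare (P : DyadicPartition) (i : Fin 3) (u : E3 → ℝ) (n : ℕ) (y : E3) : ℝ :=
  conv (kernel (lowSymbol P n)) u y ^ 2 / y i

/-! ### Telescoping of the low frequency squares -/

section

variable (P : DyadicPartition) {i : Fin 3} {M : ℝ} {u : E3 → ℝ}

theorem abs_low_le (hu : OddField i M u) (n : ℕ) (y : E3) :
    |conv (kernel (lowSymbol P n)) u y| ≤ momentConst i P.χ * M * |y i| :=
  abs_conv_dilation_le hu (isSymbol_χ P) (by positivity) y

theorem abs_low_div_le (hu : OddField i M u) (n : ℕ) (y : E3) :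
    |conv (kernel (lowSymbol P n)) u y / y i| ≤ momentConst i P.χ * M := by
  rw [abs_div]
  exact div_le_of_le_mul₀ (abs_nonneg _) (mul_nonneg (momentConst_nonneg i P.χ) hu.nonneg)
    (abs_low_le P hu n y)

theorem stronglyMeasurable_low (hu : OddField i M u) (n : ℕ) :
    StronglyMeasurable (conv (kernel (lowSymbol P n)) u) :=
  stronglyMeasurable_conv (isSymbol_lowSymbol P n).isRapid_kernel.continuous hu.continuous

theorem stronglyMeasurable_lowSquare (hu : OddField i M u) (n : ℕ) :
    StronglyMeasurable (lowSquare P i u n) := by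
  have h := stronglyMeasurable_low P hu n
  have hi : Measurable fun y : E3 => y i := Continuous.measurable (by fun_prop)
  exact ((h.measurable.pow_const 2).div hi).stronglyMeasurable

theorem abs_lowSquare_le (hu : OddField i M u) (n : ℕ) (y : E3) :
    |lowSquare P i u n y| ≤ (momentConst i P.χ * M) ^ 2 * |y i| := by
  have e : lowSquare P i u n y = conv (kernel (lowSymbol P n)) u y *
      (conv (kernel (lowSymbol P n)) u y / y i) := by
    unfold lowSquare
    ring
  rw [e, abs_mul]
  calc _ ≤ (momentConst i P.χ * M * |y i|) * (momentConst i P.χ * M) :=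
        mul_le_mul (abs_low_le P hu n y) (abs_low_div_le P hu n y) (abs_nonneg _)
          ((abs_nonneg _).trans (abs_low_le P hu n y))
    _ = _ := by ring

theorem linearGrowth_lowSquare (hu : OddField i M u) (n : ℕ) :
    LinearGrowth (lowSquare P i u n) :=
  .of_abs_le_coord (stronglyMeasurable_lowSquare P hu n).aestronglyMeasurable (by positivity)
    (abs_lowSquare_le P hu n)

theorem conv_blockSymbol_succ (hu : OddField i M u) (n : ℕ) (y : E3) :
    conv (kernel (blockSymbol P (n + 1))) u y =
      conv (kernel (lowSymbol P (n + 1))) u y - conv (kernel (lowSymbol P n)) u y := by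
  rw [conv, conv, conv, ← integral_sub
    (integrable_conv (isSymbol_lowSymbol P _).isRapid_kernel hu.linearGrowth y)
    (integrable_conv (isSymbol_lowSymbol P _).isRapid_kernel hu.linearGrowth y)]
  congr 1
  ext z
  rw [blockSymbol_succ_eq, kernel_sub (isSymbol_lowSymbol P _) (isSymbol_lowSymbol P _), sub_mul]

/-- The initial low frequency part is itself the block of index 0. The factor 2 is not sharp; it
matches the constant of the increments. -/
theorem eLpNorm_lowSquare_zero_le (hu : OddField i M u) (p : ℝ≥0∞) :
    eLpNorm (lowSquare P i u 0) p volume ≤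
      ENNReal.ofReal (2 * (momentConst i P.χ * M)) *
        eLpNorm (conv (kernel (blockSymbol P 0)) u) p volume := by
  refine eLpNorm_le_mul_eLpNorm_of_ae_le_mul (Filter.Eventually.of_forall fun y => ?_) p
  have h := abs_low_div_le P hu 0 y
  have h0 : 0 ≤ momentConst i P.χ * M := (abs_nonneg _).trans h
  rw [blockSymbol_zero_eq]
  have e : lowSquare P i u 0 y = (conv (kernel (lowSymbol P 0)) u y / y i) *
      conv (kernel (lowSymbol P 0)) u y := by
    unfold lowSquare
    ring
  rw [e, norm_mul]
  gcongr
  rw [Real.norm_eq_abs]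
  linarith

/-- Difference of two squares: the sum divided by the coordinate is bounded uniformly in n, and the
difference is one dyadic block. -/
theorem eLpNorm_lowSquare_succ_sub_le (hu : OddField i M u) (p : ℝ≥0∞) (n : ℕ) :
    eLpNorm (fun y => lowSquare P i u (n + 1) y - lowSquare P i u n y) p volume ≤
      ENNReal.ofReal (2 * (momentConst i P.χ * M)) *
        eLpNorm (conv (kernel (blockSymbol P (n + 1))) u) p volume := by
  refine eLpNorm_le_mul_eLpNorm_of_ae_le_mul (Filter.Eventually.of_forall fun y => ?_) p
  have h := abs_low_div_le P hu n y
  have h' := abs_low_div_le P hu (n + 1) y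
  rw [conv_blockSymbol_succ P hu]
  have e : lowSquare P i u (n + 1) y - lowSquare P i u n y =
      (conv (kernel (lowSymbol P (n + 1))) u y / y i + conv (kernel (lowSymbol P n)) u y / y i) *
      (conv (kernel (lowSymbol P (n + 1))) u y - conv (kernel (lowSymbol P n)) u y) := by
    unfold lowSquare
    ring
  rw [e, norm_mul]
  gcongr
  refine (abs_add_le _ _).trans ?_
  linarith

theorem tendsto_conv_lowSquare (hu : OddField i M u) {μ : E3 → ℝ} (hμ : IsSymbol μ) (x : E3) :
    Filter.Tendsto (fun n => conv (kernel μ) (lowSquare P i u n) x) Filter.atTop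
      (nhds (conv (kernel μ) (fun y => u y ^ 2 / y i) x)) := by
  have hK := hμ.isRapid_kernel
  have hKc := hK.continuous
  have hcoord : LinearGrowth fun y : E3 => (momentConst i P.χ * M) ^ 2 * |y i| :=
    .of_abs_le_coord (Continuous.aestronglyMeasurable (by fun_prop)) (sq_nonneg _)
      (fun y => by rw [abs_of_nonneg (by positivity)])
  refine tendsto_integral_of_dominated_convergence
    (fun y => |kernel μ (x - y) * ((momentConst i P.χ * M) ^ 2 * |y i|)|)
    (fun n => (Continuous.aestronglyMeasurable (by fun_prop)).mul
      (stronglyMeasurable_lowSquare P hu n).aestronglyMeasurable)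
    (integrable_conv hK hcoord x).abs
    (fun n => Filter.Eventually.of_forall fun y => ?_) (Filter.Eventually.of_forall fun y => ?_)
  · rw [norm_mul, abs_mul, Real.norm_eq_abs, Real.norm_eq_abs,
      abs_of_nonneg (by positivity : 0 ≤ (momentConst i P.χ * M) ^ 2 * |y i|)]
    gcongr
    exact abs_lowSquare_le P hu n y
  · exact (((tendsto_conv_lowSymbol P hu.linearGrowth hu.continuous y).pow 2).div_const
      (y i)).const_mul _

end

/-- Dyadic blocks of `u ^ 2 / x i` for a field that is odd in the `i`-th coordinate. -/
theorem exists_eLpNorm_block_sq_div_le (P : DyadicPartition) (i : Fin 3) :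
    ∃ (N : ℕ) (C : ℝ≥0), ∀ p : ℝ≥0∞, 1 ≤ p → ∀ (M : ℝ) (u : E3 → ℝ), OddField i M u → ∀ m : ℕ,
      eLpNorm (conv (kernel (blockSymbol P m)) fun y => u y ^ 2 / y i) p volume ≤
        C * ENNReal.ofReal M * ∑' n : ℕ, if m ≤ n + N then
          eLpNorm (conv (kernel (blockSymbol P n)) u) p volume else 0 := by
  obtain ⟨N, hN⟩ := exists_spectral_gap P i
  obtain ⟨B, hB⟩ := exists_lintegral_blockKernel_le P
  -- B comes from Young's inequality for the outer block, the other factor from the increments of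
  -- the low frequency squares.
  refine ⟨N, B * (2 * momentConst i P.χ).toNNReal, fun p hp M u hu m => ?_⟩
  have hKm := isSymbol_blockSymbol P m
  have hKc := hKm.isRapid_kernel.continuous
  set D : ℝ≥0∞ := ENNReal.ofReal (2 * (momentConst i P.χ * M)) with hD
  have hC : ((B * (2 * momentConst i P.χ).toNNReal : ℝ≥0) : ℝ≥0∞) * ENNReal.ofReal M = B * D := by
    rw [ENNReal.coe_mul, mul_assoc, hD]
    congr 1
    rw [← mul_assoc, ENNReal.ofReal_mul (mul_nonneg zero_le_two (momentConst_nonneg i P.χ))]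
    rfl
  rw [hC]
  set a : ℕ → ℝ≥0∞ := fun n => if m ≤ n + N then
    eLpNorm (conv (kernel (blockSymbol P n)) u) p volume else 0 with ha
  have hzero : ∀ n, n + N < m → conv (kernel (blockSymbol P m)) (lowSquare P i u n) = 0 := by
    intro n hn
    ext x
    exact conv_sq_div_eq_zero hu (isSymbol_lowSymbol P n) hKm (hN n m hn) x
  -- Induction on the telescoping index J. While J + N < m the left side is zero by localization, so
  -- only increments with m ≤ n + N are ever paid for.
  have hfin : ∀ J, eLpNorm (conv (kernel (blockSymbol P m)) (lowSquare P i u J)) p volume ≤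
      B * D * ∑ n ∈ Finset.range (J + 1), a n := by
    intro J
    induction J with
    | zero =>
      by_cases hm : m ≤ 0 + N
      · rw [Finset.sum_range_one, ha]
        simp only [hm, if_true]
        refine (eLpNorm_conv_le hKc (linearGrowth_lowSquare P hu 0).1 hp).trans ?_
        rw [mul_assoc]
        gcongr
        · exact hB m
        · exact eLpNorm_lowSquare_zero_le P hu p
      · rw [hzero 0 (not_le.1 hm), eLpNorm_zero]
        exact zero_le
    | succ J ih =>
      by_cases hm : m ≤ J + 1 + N
      · have e : conv (kernel (blockSymbol P m)) (lowSquare P i u (J + 1)) =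
            conv (kernel (blockSymbol P m)) (lowSquare P i u J) +
            conv (kernel (blockSymbol P m))
              (fun y => lowSquare P i u (J + 1) y - lowSquare P i u J y) := by
          ext x
          rw [Pi.add_apply, conv_sub_right hKm.isRapid_kernel (linearGrowth_lowSquare P hu _)
            (linearGrowth_lowSquare P hu _)]
          ring
        have hdm := ((linearGrowth_lowSquare P hu (J + 1)).sub (linearGrowth_lowSquare P hu J)).1
        rw [e, Finset.sum_range_succ, mul_add]
        refine (eLpNorm_add_le (aestronglyMeasurable_conv hKc (linearGrowth_lowSquare P hu J).1)
          (aestronglyMeasurable_conv hKc hdm) hp).trans (add_le_add ih ?_)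
        simp only [ha, hm, if_true]
        refine (eLpNorm_conv_le hKc hdm hp).trans ?_
        rw [mul_assoc]
        gcongr
        · exact hB m
        · exact eLpNorm_lowSquare_succ_sub_le P hu p J
      · rw [hzero (J + 1) (not_le.1 hm), eLpNorm_zero]
        exact zero_le
  -- Fatou's lemma: pointwise convergence suffices, and no summability of the blocks of u is needed.
  refine (Lp.eLpNorm_lim_le_liminf_eLpNorm
    (fun n => aestronglyMeasurable_conv hKc (linearGrowth_lowSquare P hu n).1) _
    (Filter.Eventually.of_forall fun x => tendsto_conv_lowSquare P hu hKm x)).trans ?_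
  refine Filter.liminf_le_of_le (by isBoundedDefault) fun b hb => ?_
  obtain ⟨J, hJ⟩ := hb.exists
  refine hJ.trans ((hfin J).trans ?_)
  gcongr
  exact ENNReal.sum_le_tsum _

/-! ### Swirl fields -/

/-- Rotations are transitive on horizontal circles about the axis. -/
theorem exists_rot_eq {x y : E3} (h : x 0 ^ 2 + x 1 ^ 2 = y 0 ^ 2 + y 1 ^ 2) (h2 : x 2 = y 2) :
    ∃ α ∈ Set.Icc (0 : ℝ) (2 * Real.pi), rot α x = y := by
  have key : ∃ θ : ℝ, Real.cos θ * x 0 - Real.sin θ * x 1 = y 0 ∧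
      Real.sin θ * x 0 + Real.cos θ * x 1 = y 1 := by
    by_cases h0 : x 0 ^ 2 + x 1 ^ 2 = 0
    · have hx0 : x 0 = 0 := by nlinarith [sq_nonneg (x 0), sq_nonneg (x 1)]
      have hx1 : x 1 = 0 := by nlinarith [sq_nonneg (x 0), sq_nonneg (x 1)]
      have hy0 : y 0 = 0 := by nlinarith [sq_nonneg (y 0), sq_nonneg (y 1)]
      have hy1 : y 1 = 0 := by nlinarith [sq_nonneg (y 0), sq_nonneg (y 1)]
      exact ⟨0, by simp [hx0, hx1, hy0], by simp [hx0, hx1, hy1]⟩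
    -- c + is is the complex quotient (y₀ + iy₁)/(x₀ + ix₁), of modulus one.
    · set c : ℝ := (x 0 * y 0 + x 1 * y 1) / (x 0 ^ 2 + x 1 ^ 2) with hc
      set s : ℝ := (x 0 * y 1 - x 1 * y 0) / (x 0 ^ 2 + x 1 ^ 2) with hs
      have hcs : c ^ 2 + s ^ 2 = 1 := by
        rw [hc, hs, div_pow, div_pow, ← add_div, div_eq_one_iff_eq (pow_ne_zero 2 h0)]
        linear_combination -(x 0 ^ 2 + x 1 ^ 2) * h
      have hz : ‖(⟨c, s⟩ : ℂ)‖ = 1 := by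
        rw [Complex.norm_def, Complex.normSq_mk, Real.sqrt_eq_one]
        linarith
      have hz0 : (⟨c, s⟩ : ℂ) ≠ 0 := by
        intro h
        rw [h, norm_zero] at hz
        exact zero_ne_one hz
      refine ⟨Complex.arg ⟨c, s⟩, ?_, ?_⟩
      · rw [Complex.cos_arg hz0, Complex.sin_arg, hz, div_one, div_one]
        simp only [hc, hs]
        field_simp
        ring
      · rw [Complex.cos_arg hz0, Complex.sin_arg, hz, div_one, div_one]
        simp only [hc, hs]
        field_simp
        ring
  obtain ⟨θ, h3, h4⟩ := key
  -- The angle is reduced modulo 2π, since `IsAxisymmetric` only quantifies over [0, 2π].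
  have hmem := toIcoMod_mem_Ico Real.two_pi_pos 0 θ
  rw [zero_add] at hmem
  have hmod : toIcoMod Real.two_pi_pos 0 θ = θ - toIcoDiv Real.two_pi_pos 0 θ * (2 * Real.pi) := by
    rw [toIcoMod, zsmul_eq_mul]
  have hcos : Real.cos (toIcoMod Real.two_pi_pos 0 θ) = Real.cos θ := by
    rw [hmod, Real.cos_sub_int_mul_two_pi]
  have hsin : Real.sin (toIcoMod Real.two_pi_pos 0 θ) = Real.sin θ := by
    rw [hmod, Real.sin_sub_int_mul_two_pi]
  refine ⟨toIcoMod Real.two_pi_pos 0 θ, ⟨hmem.1, hmem.2.le⟩, ?_⟩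
  ext j
  fin_cases j
  · simpa [rot, hcos, hsin] using h3
  · simpa [rot, hcos, hsin] using h4
  · simp [rot, h2]

theorem rot_rot_neg (α : ℝ) (v : E3) : rot α (rot (-α) v) = v := by
  have h := Real.sin_sq_add_cos_sq α
  ext j
  fin_cases j
  · simp [rot]
    linear_combination (v 0) * h
  · simp [rot]
    linear_combination (v 1) * h
  · simp [rot]

theorem axisDist_sq (x : E3) : axisDist x ^ 2 = x 0 ^ 2 + x 1 ^ 2 :=
  Real.sq_sqrt (by positivity)

theorem ae_axisDist_ne_zero : ∀ᵐ y : E3, axisDist y ≠ 0 := by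
  have h := Measure.addHaar_submodule (volume : Measure E3)
    (LinearMap.ker (EuclideanSpace.proj (𝕜 := ℝ) (0 : Fin 3) : E3 →L[ℝ] ℝ).toLinearMap) (by
      intro ht
      have h1 : (EuclideanSpace.single 0 1 : E3) ∈
          LinearMap.ker (EuclideanSpace.proj (𝕜 := ℝ) (0 : Fin 3) : E3 →L[ℝ] ℝ).toLinearMap := by
        rw [ht]
        exact Submodule.mem_top
      simp at h1)
  rw [ae_iff]
  refine measure_mono_null (fun y hy => ?_) h
  have h1 := axisDist_sq y
  simp only [ne_eq, not_not, Set.mem_ofPred_eq] at hy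
  rw [hy] at h1
  have h2 : y 0 = 0 := by nlinarith [sq_nonneg (y 0), sq_nonneg (y 1)]
  simpa using h2

theorem swirlRatio_of_axisDist_eq_zero (b : E3 → E3) {x : E3} (h : axisDist x = 0) :
    swirlRatio b x = 0 := by
  rw [swirlRatio, h, div_zero]

/-- The half turn fixes the points of the axis and negates horizontal components. -/
theorem IsSmoothSwirl.apply_of_axisDist_eq_zero {b : E3 → E3} (hb : IsSmoothSwirl b) {x : E3}
    (h : axisDist x = 0) : b x 0 = 0 ∧ b x 1 = 0 := by
  have h0 := axisDist_sq x
  rw [h] at h0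
  have hx0 : x 0 = 0 := by nlinarith [sq_nonneg (x 0), sq_nonneg (x 1)]
  have hx1 : x 1 = 0 := by nlinarith [sq_nonneg (x 0), sq_nonneg (x 1)]
  have hr : rot Real.pi x = x := by
    ext j
    fin_cases j <;> simp [rot, hx0, hx1]
  have h1 := hb.axisymmetric Real.pi ⟨Real.pi_pos.le, by linarith [Real.pi_pos]⟩ x
  rw [hr] at h1
  have h2 := congrArg (fun v : E3 => v 0) h1
  have h3 := congrArg (fun v : E3 => v 1) h1
  simp [rot] at h2 h3
  exact ⟨by linarith, by linarith⟩

/-- Cartesian form of b = b^θ e_θ. On the axis both sides vanish, the ratio being 0 there by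
convention. -/
theorem IsSmoothSwirl.apply_zero_one {b : E3 → E3} (hb : IsSmoothSwirl b) (x : E3) :
    b x 0 = -(x 1 * swirlRatio b x) ∧ b x 1 = x 0 * swirlRatio b x := by
  by_cases h : axisDist x = 0
  · have h1 := hb.apply_of_axisDist_eq_zero h
    rw [swirlRatio_of_axisDist_eq_zero b h, h1.1, h1.2]
    simp
  · have h1 := hb.radial_eq_zero x h
    have h2 := axisDist_sq x
    have h3 : b x 0 * x 0 + b x 1 * x 1 = 0 := by
      simp [radialPart, eR, PiLp.inner_apply, Fin.sum_univ_three] at h1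
      field_simp at h1
      linarith
    have h4 : swirlRatio b x = (x 0 * b x 1 - x 1 * b x 0) / axisDist x ^ 2 := by
      simp [swirlRatio, angularPart, eTheta, PiLp.inner_apply, Fin.sum_univ_three]
      field_simp
      ring
    rw [h4]
    constructor
    · field_simp
      linear_combination (b x 0) * h2 + x 0 * h3
    · field_simp
      linear_combination (b x 1) * h2 + x 1 * h3

/-- Axisymmetry lets the ratio be evaluated at any point of the same circle. With y a reflection of
x this yields oddness of the components. -/
theorem IsSmoothSwirl.apply_of_orbit {b : E3 → E3} (hb : IsSmoothSwirl b) {x y : E3}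
    (h : x 0 ^ 2 + x 1 ^ 2 = y 0 ^ 2 + y 1 ^ 2) (h2 : x 2 = y 2) :
    b y 0 = -(y 1 * swirlRatio b x) ∧ b y 1 = y 0 * swirlRatio b x := by
  obtain ⟨α, hα, rfl⟩ := exists_rot_eq h h2
  have h1 := congrArg (rot α) (hb.axisymmetric α hα x)
  rw [rot_rot_neg] at h1
  obtain ⟨h3, h4⟩ := hb.apply_zero_one x
  rw [h1]
  simp only [rot]
  simp [h3, h4]
  constructor <;> ring

/-- Nonempty open sets have positive measure. This upgrades the essential bound on b^θ/r to bounds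
on the components of b at every point. -/
theorem le_of_ae_le_of_continuous {f g : E3 → ℝ} (hf : Continuous f) (hg : Continuous g)
    (h : ∀ᵐ y, f y ≤ g y) (y : E3) : f y ≤ g y := by
  have ho : IsOpen {y | g y < f y} := isOpen_lt hg hf
  have h0 : volume {y | g y < f y} = 0 := by
    simpa [ae_iff] using h
  have he := (ho.measure_eq_zero_iff volume).1 h0
  by_contra hy
  have : y ∈ {y | g y < f y} := not_le.1 hy
  rw [he] at this
  exact this

theorem ae_abs_swirlRatio_le {b : E3 → E3}
    (hM : eLpNorm (swirlRatio b) ⊤ volume < ⊤) :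
    ∀ᵐ y, |swirlRatio b y| ≤ (eLpNorm (swirlRatio b) ⊤ volume).toReal := by
  rw [eLpNorm_exponent_top] at hM ⊢
  refine (enorm_ae_le_eLpNormEssSup (swirlRatio b) volume).mono fun y hy => ?_
  have := ENNReal.toReal_mono hM.ne hy
  simpa using this

theorem IsSmoothSwirl.oddField_zero {b : E3 → E3} (hb : IsSmoothSwirl b)
    (hM : eLpNorm (swirlRatio b) ⊤ volume < ⊤) :
    OddField 1 (eLpNorm (swirlRatio b) ⊤ volume).toReal (fun y => -b y 0) := by
  have hc := hb.smooth.continuous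
  have hc0 : Continuous fun y => -b y 0 := by fun_prop
  refine ⟨hc0, ENNReal.toReal_nonneg, ?_, fun y => ?_⟩
  · refine le_of_ae_le_of_continuous (by fun_prop) (by fun_prop) ?_
    refine (ae_abs_swirlRatio_le hM).mono fun y hy => ?_
    rw [(hb.apply_zero_one y).1, neg_neg, abs_mul, mul_comm]
    gcongr
  · have h := (hb.apply_of_orbit (x := y) (y := reflect 1 y) (by simp [reflect_apply])
      (by simp [reflect_apply])).1
    rw [h, (hb.apply_zero_one y).1]
    simp [reflect_apply]

theorem IsSmoothSwirl.oddField_one {b : E3 → E3} (hb : IsSmoothSwirl b)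
    (hM : eLpNorm (swirlRatio b) ⊤ volume < ⊤) :
    OddField 0 (eLpNorm (swirlRatio b) ⊤ volume).toReal (fun y => b y 1) := by
  have hc := hb.smooth.continuous
  have hc0 : Continuous fun y => b y 1 := by fun_prop
  refine ⟨hc0, ENNReal.toReal_nonneg, ?_, fun y => ?_⟩
  · refine le_of_ae_le_of_continuous (by fun_prop) (by fun_prop) ?_
    refine (ae_abs_swirlRatio_le hM).mono fun y hy => ?_
    rw [(hb.apply_zero_one y).2, abs_mul, mul_comm]
    gcongr
  · have h := (hb.apply_of_orbit (x := y) (y := reflect 0 y) (by simp [reflect_apply])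
      (by simp [reflect_apply])).2
    rw [h, (hb.apply_zero_one y).2]
    simp [reflect_apply]

/-- With W the ratio, W b₀ = -x₁W² = -(x₁W)²/x₁; on x₁ = 0 both sides are 0. -/
theorem IsSmoothSwirl.swirlProduct_zero {b : E3 → E3} (hb : IsSmoothSwirl b) (y : E3) :
    swirlProduct b y 0 = -((-b y 0) ^ 2 / y 1) := by
  simp only [swirlProduct, PiLp.smul_apply, smul_eq_mul]
  rw [(hb.apply_zero_one y).1]
  by_cases h : y 1 = 0
  · simp [h]
  · field_simp

theorem IsSmoothSwirl.swirlProduct_one {b : E3 → E3} (hb : IsSmoothSwirl b) (y : E3) :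
    swirlProduct b y 1 = b y 1 ^ 2 / y 0 := by
  simp only [swirlProduct, PiLp.smul_apply, smul_eq_mul]
  rw [(hb.apply_zero_one y).2]
  by_cases h : y 0 = 0
  · simp [h]
  · field_simp

theorem IsSmoothSwirl.swirlProduct_two {b : E3 → E3} (hb : IsSmoothSwirl b) (y : E3) :
    swirlProduct b y 2 = 0 := by
  simp only [swirlProduct, PiLp.smul_apply, smul_eq_mul]
  by_cases h : axisDist y = 0
  · rw [swirlRatio_of_axisDist_eq_zero b h, zero_mul]
  · have := hb.vertical_eq_zero y h
    rw [verticalPart] at this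
    rw [this, mul_zero]

/-! ### Dyadic blocks of vector fields -/

/-- The shift by one makes ℕ enumerate the blocks -1, 0, 1, … -/
theorem block_natCast_sub_one (P : DyadicPartition) (n : ℕ) (u : E3 → E3) (x : E3) :
    block P ((n : ℤ) - 1) u x = ∫ y, kernel (blockSymbol P n) (x - y) • u y := by
  cases n with
  | zero =>
    simp only [block, blockSymbol]
    norm_num
    rw [convolution_eq_swap]
    rfl
  | succ n =>
    have h : 0 ≤ ((n + 1 : ℕ) : ℤ) - 1 := by push_cast; linarith [Int.natCast_nonneg n]
    have e : ((n + 1 : ℕ) : ℤ) - 1 = n := by push_cast; ring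
    rw [block, if_pos h, convolution_eq_swap, e]
    congr 1
    ext1 y
    simp only [blockSymbol, ContinuousLinearMap.lsmul_apply]
    rw [kernel_comp_inv_smul P.φ (by positivity), zpow_natCast, mul_comm (3 : ℤ), zpow_mul,
      zpow_natCast]
    rfl

theorem block_of_lt (P : DyadicPartition) {q : ℤ} (hq : q < -1) (u : E3 → E3) :
    block P q u = 0 := by
  rw [block, if_neg (by omega), if_neg (by omega)]

/-- Linear growth makes the convolution integrand integrable, which is what lets coordinates pass
under the vector-valued integral. -/
theorem block_apply_coord (P : DyadicPartition) (n : ℕ) {u : E3 → E3}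
    (hu : ∀ j, LinearGrowth fun y => u y j) (x : E3) (j : Fin 3) :
    block P ((n : ℤ) - 1) u x j = conv (kernel (blockSymbol P n)) (fun y => u y j) x := by
  have hi : ∀ j, Integrable fun y => (kernel (blockSymbol P n) (x - y) • u y) j := fun j =>
    integrable_conv (isSymbol_blockSymbol P n).isRapid_kernel (hu j) x
  rw [block_natCast_sub_one, eval_integral_piLp hi]
  rfl

theorem linearGrowth_zero : LinearGrowth fun _ => 0 :=
  ⟨aestronglyMeasurable_const, 0, fun y => by simp⟩

theorem LinearGrowth.neg {u : E3 → ℝ} (hu : LinearGrowth u) : LinearGrowth fun y => -u y := by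
  simpa using linearGrowth_zero.sub hu

theorem OddField.linearGrowth_sq_div {i : Fin 3} {M : ℝ} {u : E3 → ℝ} (hu : OddField i M u) :
    LinearGrowth fun y => u y ^ 2 / y i := by
  have hi : Measurable fun y : E3 => y i := Continuous.measurable (by fun_prop)
  have hm := ((hu.continuous.measurable.pow_const 2).div hi).aestronglyMeasurable (μ := volume)
  refine .of_abs_le_coord (M := M ^ 2) (i := i) hm (sq_nonneg M) fun y => ?_
  have h1 : |u y| ^ 2 ≤ (M * |y i|) ^ 2 := by
    gcongr
    exact hu.bound y
  rw [abs_div, abs_pow]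
  refine div_le_of_le_mul₀ (abs_nonneg _) (by positivity) (h1.trans_eq (by ring))

theorem conv_neg (k u : E3 → ℝ) : conv k (fun y => -u y) = -conv k u := by
  ext x
  simp [conv, integral_neg]

theorem eLpNorm_le_sum_coord {f : E3 → E3} {p : ℝ≥0∞} (hp : 1 ≤ p)
    (hf : ∀ j, AEStronglyMeasurable (fun x => f x j) volume) :
    eLpNorm f p volume ≤ ∑ j, eLpNorm (fun x => f x j) p volume := by
  have h1 : eLpNorm f p volume ≤ eLpNorm (fun x => ∑ j, ‖f x j‖) p volume := by
    refine eLpNorm_mono_real fun x => ?_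
    rw [EuclideanSpace.norm_eq]
    refine Real.sqrt_le_left (Finset.sum_nonneg fun j _ => norm_nonneg _) |>.2 ?_
    exact Finset.sum_sq_le_sq_sum_of_nonneg fun j _ => norm_nonneg _
  refine h1.trans ?_
  have h2 := eLpNorm_sum_le (s := Finset.univ) (f := fun j x => ‖f x j‖)
    (fun j _ => (hf j).norm) hp
  refine (le_of_eq ?_).trans (h2.trans_eq (Finset.sum_congr rfl fun j _ => eLpNorm_norm _))
  congr 1 with x

/-- Dyadic blocks of `(b^θ / r) b` are controlled by the blocks of `b` of at least the same
frequency, up to a fixed gap. -/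
theorem exists_eLpNorm_block_swirlProduct_le (P : DyadicPartition) :
    ∃ (N : ℕ) (C : ℝ≥0), ∀ p : ℝ≥0∞, 1 ≤ p → ∀ b : E3 → E3, IsSmoothSwirl b →
      eLpNorm (swirlRatio b) ⊤ volume < ⊤ → ∀ m : ℕ,
      eLpNorm (block P ((m : ℤ) - 1) (swirlProduct b)) p volume ≤
        C * eLpNorm (swirlRatio b) ⊤ volume * ∑' n : ℕ, if m ≤ n + N then
          eLpNorm (block P ((n : ℤ) - 1) b) p volume else 0 := by
  obtain ⟨N₀, C₀, h₀⟩ := exists_eLpNorm_block_sq_div_le P 1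
  obtain ⟨N₁, C₁, h₁⟩ := exists_eLpNorm_block_sq_div_le P 0
  refine ⟨max N₀ N₁, C₀ + C₁, fun p hp b hb hM m => ?_⟩
  have o₀ := hb.oddField_zero hM
  have o₁ := hb.oddField_one hM
  set W := eLpNorm (swirlRatio b) ⊤ volume with hW
  have hWr : ENNReal.ofReal W.toReal = W := ENNReal.ofReal_toReal hM.ne
  have g₀ : LinearGrowth fun y => b y 0 := by simpa using o₀.linearGrowth.neg
  have hb2 : LinearGrowth fun y => b y 2 := by
    have hc := hb.smooth.continuous
    -- The growth constant is 0: b₂ vanishes off the axis, a null set, hence everywhere by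
    -- continuity.
    refine ⟨Continuous.aestronglyMeasurable (by fun_prop), 0, fun y => ?_⟩
    rw [zero_mul]
    refine le_of_ae_le_of_continuous (g := fun _ => 0) (f := fun y => |b y 2|) (by fun_prop) (by fun_prop) ?_ y
    refine ae_axisDist_ne_zero.mono fun y hy => ?_
    have := hb.vertical_eq_zero y hy
    rw [verticalPart] at this
    simp [this]
  have gb : ∀ j, LinearGrowth fun y => b y j := by
    intro j
    fin_cases j
    · exact g₀
    · exact o₁.linearGrowth
    · exact hb2
  have gw : ∀ j, LinearGrowth fun y => swirlProduct b y j := by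
    intro j
    fin_cases j
    · simpa only [Fin.zero_eta, hb.swirlProduct_zero] using o₀.linearGrowth_sq_div.neg
    · simpa only [Fin.mk_one, hb.swirlProduct_one] using o₁.linearGrowth_sq_div
    · simpa only [Fin.reduceFinMk, hb.swirlProduct_two] using linearGrowth_zero
  have hcoord : ∀ (n : ℕ) (j : Fin 3), eLpNorm (conv (kernel (blockSymbol P n)) fun y => b y j) p
      volume ≤ eLpNorm (block P ((n : ℤ) - 1) b) p volume := by
    intro n j
    refine eLpNorm_mono fun x => ?_
    rw [← block_apply_coord P n gb]
    exact PiLp.norm_apply_le _ _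
  have hsum : ∀ (N' : ℕ), N' ≤ max N₀ N₁ → ∀ (v : E3 → ℝ), (∀ n, eLpNorm
      (conv (kernel (blockSymbol P n)) v) p volume ≤ eLpNorm (block P ((n : ℤ) - 1) b) p volume) →
      (∑' n : ℕ, if m ≤ n + N' then eLpNorm (conv (kernel (blockSymbol P n)) v) p volume else 0) ≤
      ∑' n : ℕ, if m ≤ n + max N₀ N₁ then
        eLpNorm (block P ((n : ℤ) - 1) b) p volume else 0 := by
    intro N' hN' v hv
    refine ENNReal.tsum_le_tsum fun n => ?_
    by_cases hn : m ≤ n + N'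
    · rw [if_pos hn, if_pos (by omega)]
      exact hv n
    · rw [if_neg hn]
      exact zero_le
  have hKc := (isSymbol_blockSymbol P m).isRapid_kernel.continuous
  have hcw : ∀ j, (fun x => block P ((m : ℤ) - 1) (swirlProduct b) x j) =
      conv (kernel (blockSymbol P m)) (fun y => swirlProduct b y j) := fun j =>
    funext fun x => block_apply_coord P m gw x j
  refine (eLpNorm_le_sum_coord hp fun j => ?_).trans ?_
  · rw [hcw]
    exact aestronglyMeasurable_conv hKc (gw j).1
  simp only [hcw, Fin.sum_univ_three, hb.swirlProduct_zero, hb.swirlProduct_one,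
    hb.swirlProduct_two]
  have hz : conv (kernel (blockSymbol P m)) (fun _ => 0) = 0 := by
    ext x
    simp [conv]
  rw [hz, eLpNorm_zero, add_zero, conv_neg, eLpNorm_neg, ENNReal.coe_add, add_mul, add_mul]
  refine add_le_add ((h₀ p hp _ _ o₀ m).trans ?_) ((h₁ p hp _ _ o₁ m).trans ?_)
  · rw [hWr]
    refine mul_le_mul_right (hsum N₀ (le_max_left _ _) _ fun n => ?_) _
    rw [conv_neg, eLpNorm_neg]
    exact hcoord n 0
  · rw [hWr]
    exact mul_le_mul_right (hsum N₁ (le_max_right _ _) _ fun n => hcoord n 1) _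

/-! ### Summation over the dyadic blocks -/

/-- Minkowski's inequality for series of sequences. -/
theorem eLpNorm_count_tsum_le {r : ℝ≥0∞} (hr : 1 ≤ r) (hr' : r ≠ ⊤) (f : ℕ → ℤ → ℝ≥0∞) :
    eLpNorm (fun q => ∑' k, f k q) r Measure.count ≤ ∑' k, eLpNorm (f k) r Measure.count := by
  have hr0 : r ≠ 0 := (zero_lt_one.trans_le hr).ne'
  have hpos : 0 < r.toReal := ENNReal.toReal_pos hr0 hr'
  have hfin : ∀ n : ℕ, ∫⁻ q : ℤ, (∑ k ∈ Finset.range n, f k q) ^ r.toReal ∂Measure.count ≤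
      (∑' k, eLpNorm (f k) r Measure.count) ^ r.toReal := by
    intro n
    have h := eLpNorm_sum_le (μ := (Measure.count : Measure ℤ)) (s := Finset.range n) (f := f)
      (fun k _ => (measurable_of_countable (f k)).aestronglyMeasurable) hr
    have h2 := h.trans (ENNReal.sum_le_tsum _)
    rw [eLpNorm_eq_lintegral_rpow_enorm_toReal hr0 hr', one_div,
      ENNReal.rpow_inv_le_iff hpos] at h2
    simpa using h2
  rw [eLpNorm_eq_lintegral_rpow_enorm_toReal hr0 hr', one_div, ENNReal.rpow_inv_le_iff hpos]
  simp only [enorm_eq_self]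
  -- Monotone convergence passes from Minkowski's inequality for partial sums to the series.
  refine le_of_tendsto' (lintegral_tendsto_of_tendsto_of_monotone
    (f := fun n q => (∑ k ∈ Finset.range n, f k q) ^ r.toReal)
    (fun n => (measurable_of_countable _).aemeasurable)
    (Filter.Eventually.of_forall fun q n n' hn => ?_)
    (Filter.Eventually.of_forall fun q => ?_)) hfin
  · exact ENNReal.rpow_le_rpow (Finset.sum_le_sum_of_subset (Finset.range_mono hn)) hpos.le
  · exact (ENNReal.continuous_rpow_const.tendsto _).comp (ENNReal.tendsto_nat_tsum _)

theorem eLpNorm_count_comp_add_right (f : ℤ → ℝ≥0∞) (r : ℝ≥0∞) (j : ℤ) :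
    eLpNorm (fun q => f (q + j)) r Measure.count = eLpNorm f r Measure.count :=
  eLpNorm_comp_measurePreserving (measurable_of_countable f).aestronglyMeasurable
    (measurePreserving_add_right Measure.count j)

theorem two_rpow_add (x y : ℝ) : (2 : ℝ≥0∞) ^ (x + y) = 2 ^ x * 2 ^ y :=
  ENNReal.rpow_add x y two_ne_zero ENNReal.ofNat_ne_top

/-- Weighted sequences controlled by tails of another sequence. -/
theorem exists_eLpNorm_count_le {s : ℝ} (hs : 0 < s) (N : ℕ) {r : ℝ≥0∞} (hr : 1 ≤ r)
    (hr' : r ≠ ⊤) : ∃ C : ℝ≥0, ∀ (K : ℝ≥0∞) (a c : ℤ → ℝ≥0∞),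
      (∀ q, a q ≤ K * ∑' k : ℕ, c (q + (k - N))) →
      eLpNorm (fun q : ℤ => (2 : ℝ≥0∞) ^ ((q : ℝ) * s) * a q) r Measure.count ≤
        C * K * eLpNorm (fun q : ℤ => (2 : ℝ≥0∞) ^ ((q : ℝ) * s) * c q) r Measure.count := by
  -- Shifting the index from q to q + k - N changes the weight by 2^((N-k)s), a geometric sequence
  -- in k that is summable because s > 0.
  set d : ℕ → ℝ≥0∞ := fun k => (2 : ℝ≥0∞) ^ (((N : ℝ) - k) * s) with hd
  have hsum : ∑' k, d k ≠ ⊤ := by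
    have e : d = fun k => (2 : ℝ≥0∞) ^ ((N : ℝ) * s) * ((2 : ℝ≥0∞) ^ (-s)) ^ k := by
      ext k
      simp only [hd]
      rw [← ENNReal.rpow_natCast, ← ENNReal.rpow_mul, ← two_rpow_add]
      congr 1
      ring
    rw [e, ENNReal.tsum_mul_left, ENNReal.tsum_geometric]
    refine ENNReal.mul_ne_top (ENNReal.rpow_ne_top_of_nonneg (by positivity)
      ENNReal.ofNat_ne_top) ?_
    rw [ENNReal.inv_ne_top, Ne, tsub_eq_zero_iff_le, not_le]
    exact ENNReal.rpow_lt_one_of_one_lt_of_neg (by norm_num) (by linarith)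
  refine ⟨(∑' k, d k).toNNReal, fun K a c h => ?_⟩
  rw [ENNReal.coe_toNNReal hsum]
  set Y : ℤ → ℝ≥0∞ := fun q => (2 : ℝ≥0∞) ^ ((q : ℝ) * s) * c q with hY
  have hpt : ∀ q : ℤ, (2 : ℝ≥0∞) ^ ((q : ℝ) * s) * a q ≤
      ∑' k : ℕ, K * d k * Y (q + (k - N)) := by
    intro q
    calc (2 : ℝ≥0∞) ^ ((q : ℝ) * s) * a q
        ≤ 2 ^ ((q : ℝ) * s) * (K * ∑' k : ℕ, c (q + (k - N))) := by gcongr; exact h q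
      _ = ∑' k : ℕ, 2 ^ ((q : ℝ) * s) * (K * c (q + (k - N))) := by
          rw [ENNReal.tsum_mul_left, ENNReal.tsum_mul_left]
      _ = _ := by
          congr 1
          ext k
          have e : (2 : ℝ≥0∞) ^ ((q : ℝ) * s) =
              d k * 2 ^ (((q + (k - N) : ℤ) : ℝ) * s) := by
            rw [hd, ← two_rpow_add]
            congr 1
            push_cast
            ring
          rw [e, hY]
          ring
  calc _ ≤ eLpNorm (fun q : ℤ => ∑' k : ℕ, K * d k * Y (q + (k - N))) r Measure.count :=
        eLpNorm_mono_enorm fun q => by simpa using hpt q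
    _ ≤ ∑' k : ℕ, eLpNorm (fun q : ℤ => K * d k * Y (q + (k - N))) r Measure.count :=
        eLpNorm_count_tsum_le hr hr' _
    _ ≤ ∑' k : ℕ, K * d k * eLpNorm Y r Measure.count := by
        refine ENNReal.tsum_le_tsum fun k => ?_
        rw [← eLpNorm_count_comp_add_right Y r (k - N)]
        have hr0 : r ≠ 0 := (zero_lt_one.trans_le hr).ne'
        have hpos : 0 < r.toReal := ENNReal.toReal_pos hr0 hr'
        simp only [eLpNorm_eq_lintegral_rpow_enorm_toReal hr0 hr', enorm_eq_self,
          ENNReal.mul_rpow_of_nonneg _ _ hpos.le]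
        rw [lintegral_const_mul _ (measurable_of_countable _),
          ENNReal.mul_rpow_of_nonneg _ _ (by positivity), ← ENNReal.mul_rpow_of_nonneg _ _ hpos.le,
          ← ENNReal.rpow_mul, mul_one_div_cancel hpos.ne', ENNReal.rpow_one]
    _ = _ := by
        rw [ENNReal.tsum_mul_right, ENNReal.tsum_mul_left]
        ring

/-- Dyadic blocks of `(b^θ / r) b`, with all blocks indexed by `ℤ`. -/
theorem exists_eLpNorm_block_swirlProduct_le_tail (P : DyadicPartition) :
    ∃ (N : ℕ) (C : ℝ≥0), ∀ p : ℝ≥0∞, 1 ≤ p → ∀ b : E3 → E3, IsSmoothSwirl b →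
      eLpNorm (swirlRatio b) ⊤ volume < ⊤ → ∀ q : ℤ,
      eLpNorm (block P q (swirlProduct b)) p volume ≤
        C * eLpNorm (swirlRatio b) ⊤ volume *
          ∑' k : ℕ, eLpNorm (block P (q + (k - N)) b) p volume := by
  obtain ⟨N, C, h⟩ := exists_eLpNorm_block_swirlProduct_le P
  refine ⟨N, C, fun p hp b hb hM q => ?_⟩
  rcases lt_or_ge q (-1) with hq | hq
  · rw [block_of_lt P hq, eLpNorm_zero]
    exact zero_le
  · obtain ⟨m, hm⟩ : ∃ m : ℕ, q = (m : ℤ) - 1 := ⟨(q + 1).toNat, by omega⟩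
    subst hm
    refine (h p hp b hb hM m).trans (mul_le_mul_right ?_ _)
    set g : ℕ → ℝ≥0∞ := fun k => eLpNorm (block P ((m : ℤ) - 1 + (k - N)) b) p volume with hg
    have e : (fun n : ℕ => if m ≤ n + N then eLpNorm (block P ((n : ℤ) - 1) b) p volume else 0) =
        Set.indicator {n : ℕ | m ≤ n + N} fun n => g (n + N - m) := by
      ext n
      by_cases hn : m ≤ n + N
      · rw [if_pos hn, Set.indicator_of_mem (by exact hn), hg]
        have : (m : ℤ) - 1 + (((n + N - m : ℕ) : ℤ) - N) = (n : ℤ) - 1 := by omega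
        simp only [this]
      · rw [if_neg hn, Set.indicator_of_notMem (by exact hn)]
    rw [e, ← tsum_subtype]
    -- The substitution k = n + N - m is injective on m ≤ n + N, where natural subtraction is exact;
    -- an inequality suffices, so surjectivity is not needed.
    refine ENNReal.tsum_comp_le_tsum_of_injective (f := fun n : {n : ℕ | m ≤ n + N} =>
      (n : ℕ) + N - m) (fun n n' hnn => ?_) g
    have h1 : m ≤ (n : ℕ) + N := n.2
    have h2 : m ≤ (n' : ℕ) + N := n'.2
    apply Subtype.ext
    simp only at hnn
    omega

/-- Measurability in time is needed to exchange sum and time integral. For almost every τ the slice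
of a jointly measurable representative agrees a.e. with b τ, so the convolutions agree at every x.
-/
theorem aemeasurable_eLpNorm_block (P : DyadicPartition) {t : ℝ} {b : ℝ → E3 → E3}
    (hb : AEStronglyMeasurable (fun z : ℝ × E3 => b z.1 z.2)
      ((volume.restrict (Set.Ioo 0 t)).prod volume)) {p : ℝ≥0∞} (hp : p ≠ 0) (hp' : p ≠ ⊤)
    (q : ℤ) :
    AEMeasurable (fun τ => eLpNorm (block P q (b τ)) p volume)
      (volume.restrict (Set.Ioo 0 t)) := by
  rcases lt_or_ge q (-1) with hq | hq
  · simp only [block_of_lt P hq, eLpNorm_zero]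
    exact aemeasurable_const
  · obtain ⟨n, hn⟩ : ∃ n : ℕ, q = (n : ℤ) - 1 := ⟨(q + 1).toNat, by omega⟩
    subst hn
    have hkc := (isSymbol_blockSymbol P n).isRapid_kernel.continuous
    have hgm : StronglyMeasurable (hb.mk _) := hb.stronglyMeasurable_mk
    set g : ℝ × E3 → E3 := hb.mk _ with hg
    set F : ℝ × E3 → E3 := fun z => ∫ y, kernel (blockSymbol P n) (z.2 - y) • g (z.1, y) with hF
    have hFm : StronglyMeasurable F := by
      have h1 : StronglyMeasurable fun z : (ℝ × E3) × E3 =>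
          kernel (blockSymbol P n) (z.1.2 - z.2) • g (z.1.1, z.2) := by
        have hc : Continuous fun z : (ℝ × E3) × E3 =>
            kernel (blockSymbol P n) (z.1.2 - z.2) := by fun_prop
        refine hc.stronglyMeasurable.smul ?_
        exact hgm.comp_measurable (by fun_prop)
      exact h1.integral_prod_right'
    refine ⟨fun τ => (∫⁻ x, ‖F (τ, x)‖ₑ ^ p.toReal) ^ (1 / p.toReal), ?_, ?_⟩
    · have h2 : Measurable fun z => ‖F z‖ₑ ^ p.toReal := hFm.enorm.pow_const _
      exact h2.lintegral_prod_right'.pow_const _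
    · refine (Measure.ae_ae_of_ae_prod hb.ae_eq_mk).mono fun τ hτ => ?_
      simp only
      rw [eLpNorm_eq_lintegral_rpow_enorm_toReal hp hp']
      congr 1
      refine lintegral_congr fun x => ?_
      rw [block_natCast_sub_one, hF]
      congr 2
      refine integral_congr_ae (hτ.mono fun y hy => ?_)
      simp only at hy ⊢
      rw [hy]
end AxisymmetricProduct

end

/-! ### The two product estimates -/

open AxisymmetricProduct in
theorem propositionA1 (P : DyadicPartition) :
    (∀ s : ℝ, 0 < s → ∃ C : ℝ≥0, ∀ t : ℝ, 0 < t → ∀ b : ℝ → E3 → E3,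
      AEStronglyMeasurable (fun z : ℝ × E3 => b z.1 z.2)
        ((volume.restrict (Set.Ioo 0 t)).prod volume) →
      (∀ τ ∈ Set.Ioo 0 t, IsSmoothSwirl (b τ)) →
      timeSpaceNorm t ⊤ ⊤ (fun τ => swirlRatio (b τ)) < ⊤ →
      cheminLernerNorm P t 1 s 2 2 (fun τ => swirlProduct (b τ)) ≤
        C * timeSpaceNorm t ⊤ ⊤ (fun τ => swirlRatio (b τ)) * cheminLernerNorm P t 1 s 2 2 b) ∧
    (∀ p : ℝ≥0∞, 1 ≤ p → ∃ C : ℝ≥0, ∀ b : E3 → E3,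
      IsSmoothSwirl b →
      eLpNorm (swirlRatio b) ⊤ volume < ⊤ →
      besovNorm P (3 * p⁻¹.toReal + 1) p 1 (swirlProduct b) ≤
        C * eLpNorm (swirlRatio b) ⊤ volume * besovNorm P (3 * p⁻¹.toReal + 1) p 1 b) := by
  obtain ⟨N, C, h⟩ := exists_eLpNorm_block_swirlProduct_le_tail P
  constructor
  · intro s hs
    obtain ⟨C', h'⟩ := exists_eLpNorm_count_le hs N one_le_two ENNReal.ofNat_ne_top
    refine ⟨C' * C, fun t _ b hbm hb hM => ?_⟩
    rw [ENNReal.coe_mul, mul_assoc (C' : ℝ≥0∞)]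
    refine h' _ _ _ fun q => ?_
    set W := timeSpaceNorm t ⊤ ⊤ (fun τ => swirlRatio (b τ)) with hW
    have hae : ∀ᵐ τ ∂(volume.restrict (Set.Ioo 0 t)), eLpNorm (swirlRatio (b τ)) ⊤ volume ≤ W := by
      have := enorm_ae_le_eLpNormEssSup (fun τ => eLpNorm (swirlRatio (b τ)) ⊤ volume)
        (volume.restrict (Set.Ioo 0 t))
      simpa [hW, timeSpaceNorm] using this
    simp only [timeSpaceNorm, eLpNorm_one_eq_lintegral_enorm, enorm_eq_self]
    have hm := fun j => aemeasurable_eLpNorm_block P hbm (p := 2) two_ne_zero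
      ENNReal.ofNat_ne_top j
    -- Tonelli: the tail sum moves inside the time integral, so the fixed-time block estimate
    -- applies for almost every τ.
    rw [← lintegral_tsum fun k : ℕ => hm (q + (k - N)),
      ← lintegral_const_mul'' _ (AEMeasurable.tsum fun k : ℕ => hm (q + (k - N)))]
    refine lintegral_mono_ae ?_
    filter_upwards [hae, ae_restrict_mem measurableSet_Ioo] with τ hτ hτ'
    refine (h 2 one_le_two (b τ) (hb τ hτ') (hτ.trans_lt hM) q).trans ?_
    gcongr
  · intro p hp
    -- The regularity index enters only through its positivity; for p = ∞ it equals 1.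
    have hs : 0 < 3 * p⁻¹.toReal + 1 := by positivity
    obtain ⟨C', h'⟩ := exists_eLpNorm_count_le hs N le_rfl ENNReal.one_ne_top
    refine ⟨C' * C, fun b hb hM => ?_⟩
    rw [ENNReal.coe_mul, mul_assoc (C' : ℝ≥0∞)]
    exact h' _ _ _ fun q => h p hp b hb hM q
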